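/- Throughout, a monoid is a commutative monoid with an absorbing element $0$ (a pointed abelian monoid), and morphisms of monoids preserve products, $1$ and $0$. For a monoid $A$, $\mathrm{MSpec}(A)$ is the set of prime ideals of $A$ with its Zariski topology and its structure sheaf of monoids, whose stalk at $\mathfrak p$ is $A_{\mathfrak p}$. A monoid scheme is a topological space with a sheaf of monoids that is locally isomorphic to some $\mathrm{MSpec}(A)$; morphisms are continuous maps together with morphisms of sheaves that are local on stalks. A valuation monoid is a nonzero monoid $V$ that is cancellative ($ab=ac$ and $a\neq 0$ imply $b=c$) and such that for every nonzero $\alpha$ in its pointed group completion $V^+$ (the localization of $V$ at its nonzero elements) at least one of $\alpha$, $1/\alpha$ belongs to $V$. A morphism $f\colon X\to Y$ of monoid schemes satisfies the valuative criterion of properness (resp. separatedness) if for every valuation monoid $V$ and all morphisms $i_1\colon \mathrm{MSpec}(V^+)\to X$ and $i_2\colon \mathrm{MSpec}(V)\to Y$ whose composites $\mathrm{MSpec}(V^+)\to X\to Y$ and $\mathrm{MSpec}(V^+)\to \mathrm{MSpec}(V)\to Y$ agree, there is a unique (resp. at most one) morphism $\mathrm{MSpec}(V)\to X$ making both triangles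 commute. Let $k$ be a field. For a monoid $A$, let $k[A]$ be the free $k$-module on $A$ modulo the summand spanned by the base point $0$, with the product induced by that of $A$. The $k$-realization $X_k$ of a monoid scheme $X$ is the scheme obtained by gluing the affine schemes $\mathrm{Spec}\,k[\mathcal A(U)]$, where $U$ runs through the affine open subsets of $X$ and $\mathcal A$ is the structure sheaf; $f_k\colon X_k\to Y_k$ is the induced morphism. A morphism $g\colon S\to T$ of schemes satisfies the classical valuative criterion of properness (resp. separatedness) if for every valuation ring $R$ with field of fractions $F$ and every commutative square formed by morphisms $\mathrm{Spec}\,F\to S$ and $\mathrm{Spec}\,R\to T$, the inclusion $\mathrm{Spec}\,F\to\mathrm{Spec}\,R$ and $g$, there is a unique (resp. at most one) morphism $\mathrm{Spec}\,R\to S$ making both triangles commute. **Theorem.** Let $f\colon X\to Y$ be a morphism of monoid schemes and let $k$ be a field. Then $f_k\colon X_k\to Y_k$ satisfies the valuative criterion of properness if and only if $f$ satisfies the valuative criterion of properness; and $f_k$ satisfies the valuative criterion of separatedness if and only if $f$ satisfies the valuative criterion of separatedness. -/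

import Mathlib

open CategoryTheory TopologicalSpace Opposite AlgebraicGeometry

universe u

noncomputable section

/-- A pointed (abelian) monoid: a commutative monoid with an absorbing element `0`. -/
structure PtdMon : Type (u + 1) where
  of ::
  /-- the underlying set -/
  carrier : Type u
  [str : CommMonoidWithZero carrier]

namespace PtdMon

attribute [instance] str

instance : CoeSort PtdMon.{u} (Type u) := ⟨carrier⟩

/-- Morphisms of pointed monoids are the multiplicative maps preserving `0` and `1`. -/
instance : Category PtdMon.{u} where
  Hom A B := A →*₀ B
  id A := MonoidWithZeroHom.id A
  comp f g := MonoidWithZeroHom.comp g f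

instance : ConcreteCategory PtdMon.{u} (fun A B => A →*₀ B) where
  hom f := f
  ofHom f := f

theorem id_apply {A : PtdMon.{u}} (a : A) : (𝟙 A : A ⟶ A) a = a := rfl

theorem comp_apply {A B C : PtdMon.{u}} (f : A ⟶ B) (g : B ⟶ C) (a : A) :
    (f ≫ g) a = g (f a) := rfl

end PtdMon

/-- A prime ideal of a pointed monoid. -/
@[ext]
structure MPrime (A : Type u) [CommMonoidWithZero A] where
  /-- the underlying set -/
  carrier : Set A
  zero_mem : 0 ∈ carrier
  mul_mem : ∀ a b, b ∈ carrier → a * b ∈ carrier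
  one_notMem : (1 : A) ∉ carrier
  mem_or_mem : ∀ a b, a * b ∈ carrier → a ∈ carrier ∨ b ∈ carrier

namespace MPrime

variable {A B C : Type u} [CommMonoidWithZero A] [CommMonoidWithZero B] [CommMonoidWithZero C]

/-- The complement of a prime ideal, a multiplicatively closed subset. -/
def compl (p : MPrime A) : Submonoid A where
  carrier := {a | a ∉ p.carrier}
  one_mem' := p.one_notMem
  mul_mem' {a b} ha hb h := (p.mem_or_mem a b h).elim ha hb

/-- The Zariski topology: a set is open if and only if it is a union of principal open
subsets `D(s) = {p | s ∉ p}`. -/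
instance : TopologicalSpace (MPrime A) where
  IsOpen U := ∀ p ∈ U, ∃ s ∈ p.compl, ∀ q : MPrime A, s ∈ q.compl → q ∈ U
  isOpen_univ p _ := ⟨1, p.compl.one_mem, fun _ _ => Set.mem_univ _⟩
  isOpen_inter U V hU hV p hp := by
    obtain ⟨s, hs, hs'⟩ := hU p hp.1
    obtain ⟨t, ht, ht'⟩ := hV p hp.2
    refine ⟨s * t, p.compl.mul_mem hs ht, fun q hq => ⟨hs' q fun h => hq ?_, ht' q fun h => hq ?_⟩⟩
    · rw [mul_comm]; exact q.mul_mem _ _ h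
    · exact q.mul_mem _ _ h
  isOpen_sUnion 𝒰 h p hp := by
    obtain ⟨U, hU, hpU⟩ := hp
    obtain ⟨s, hs, hs'⟩ := h U hU p hpU
    exact ⟨s, hs, fun q hq => ⟨U, hU, hs' q hq⟩⟩

theorem isOpen_iff {U : Set (MPrime A)} :
    IsOpen U ↔ ∀ p ∈ U, ∃ s ∈ p.compl, ∀ q : MPrime A, s ∈ q.compl → q ∈ U := Iff.rfl

/-- The principal open subset `D(s)`. -/
def basicOpen (s : A) : Opens (MPrime A) where
  carrier := {p | s ∈ p.compl}
  is_open' _ hp := ⟨s, hp, fun _ hq => hq⟩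

/-- The inverse image of a prime ideal. -/
def comap (φ : A →*₀ B) (q : MPrime B) : MPrime A where
  carrier := φ ⁻¹' q.carrier
  zero_mem := by simpa using q.zero_mem
  mul_mem a b hb := by simpa using q.mul_mem _ _ hb
  one_notMem := by simpa using q.one_notMem
  mem_or_mem a b h := q.mem_or_mem _ _ (by simpa using h)

theorem continuous_comap (φ : A →*₀ B) : Continuous (comap φ) :=
  continuous_def.2 fun _ hU q hq => by
    obtain ⟨s, hs, hs'⟩ := hU _ hq
    exact ⟨φ s, hs, fun q' hq' => hs' (comap φ q') hq'⟩

/-- The map `A_{φ⁻¹ q} → B_q` induced by `φ : A → B`. -/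
def locMap (φ : A →*₀ B) (q : MPrime B) :
    Localization (comap φ q).compl →*₀ Localization q.compl where
  toFun x := x.liftOn (fun a t => Localization.mk (φ a) ⟨φ t, t.2⟩) <| by
    intro a c b d h
    obtain ⟨e, he⟩ := Localization.r_iff_exists.1 h
    refine Localization.mk_eq_mk_iff.2 (Localization.r_iff_exists.2 ⟨⟨φ e, e.2⟩, ?_⟩)
    simpa using congrArg φ he
  map_zero' := by
    rw [Localization.liftOn_zero]; simp [Localization.mk_zero]
  map_one' := by
    rw [← Localization.mk_one, Localization.liftOn_mk]; simp [← Localization.mk_one]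
  map_mul' x y := by
    induction x, y using Localization.induction_on₂ with | H x y => ?_
    simp only [Localization.mk_mul, Localization.liftOn_mk, map_mul]
    congr 1
    exact Subtype.ext (by simp)

theorem locMap_mk (φ : A →*₀ B) (q : MPrime B) (a : A) (t : (comap φ q).compl) :
    locMap φ q (Localization.mk a t) = Localization.mk (φ a) ⟨φ t, t.2⟩ := rfl

/-- A family `s = (s_p)`, `s_p ∈ A_p`, is locally a fraction on `U`. -/
def IsLocallyFraction (U : Opens (MPrime A)) (s : ∀ p : U, Localization p.1.compl) : Prop :=
  ∀ p : U, ∃ (V : Opens (MPrime A)) (_ : p.1 ∈ V) (hVU : V ≤ U) (a t : A),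
    ∀ (q : MPrime A) (hq : q ∈ V), ∃ ht : t ∈ q.compl, s ⟨q, hVU hq⟩ = Localization.mk a ⟨t, ht⟩

/-- The sections over `U` of the structure sheaf of the spectrum of `A`: the elements of
`∏_{p ∈ U} A_p` which are locally fractions. -/
structure Sections (U : Opens (MPrime A)) : Type u where
  /-- the family of germs -/
  val : ∀ p : U, Localization p.1.compl
  property : IsLocallyFraction U val

namespace Sections

variable {U V : Opens (MPrime A)}

theorem ext' {s t : Sections U} (h : ∀ p, s.1 p = t.1 p) : s = t := by
  cases s; cases t; congr; exact funext h

instance : CommMonoidWithZero (Sections U) where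
  mul s t := ⟨fun p => s.1 p * t.1 p, fun p => by
    obtain ⟨V, hpV, hV, a, x, h⟩ := s.2 p
    obtain ⟨W, hpW, hW, b, y, h'⟩ := t.2 p
    refine ⟨V ⊓ W, ⟨hpV, hpW⟩, inf_le_left.trans hV, a * b, x * y, fun q hq => ?_⟩
    obtain ⟨hx, e⟩ := h q hq.1
    obtain ⟨hy, e'⟩ := h' q hq.2
    refine ⟨q.compl.mul_mem hx hy, ?_⟩
    dsimp only; rw [e, e', Localization.mk_mul]; rfl⟩
  one := ⟨fun _ => 1, fun p => ⟨U, p.2, le_rfl, 1, 1, fun q _ =>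
    ⟨q.compl.one_mem, Localization.mk_one.symm⟩⟩⟩
  zero := ⟨fun _ => 0, fun p => ⟨U, p.2, le_rfl, 0, 1, fun q _ =>
    ⟨q.compl.one_mem, (Localization.mk_zero _).symm⟩⟩⟩
  mul_assoc a b c := ext' (fun p => mul_assoc (a.1 p) (b.1 p) (c.1 p))
  one_mul a := ext' (fun p => one_mul (a.1 p))
  mul_one a := ext' (fun p => mul_one (a.1 p))
  mul_comm a b := ext' (fun p => mul_comm (a.1 p) (b.1 p))
  zero_mul a := ext' (fun p => zero_mul (a.1 p))
  mul_zero a := ext' (fun p => mul_zero (a.1 p))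

/-- Restriction of sections. -/
def res (h : V ≤ U) : Sections U →*₀ Sections V where
  toFun s := ⟨fun p => s.1 ⟨p.1, h p.2⟩, fun p => by
    obtain ⟨W, hpW, hW, a, x, e⟩ := s.2 ⟨p.1, h p.2⟩
    exact ⟨W ⊓ V, ⟨hpW, p.2⟩, inf_le_right, a, x, fun q hq => e q hq.1⟩⟩
  map_zero' := rfl
  map_one' := rfl
  map_mul' _ _ := rfl

/-- The map on sections induced by a morphism of pointed monoids `φ : A → B`; at a prime ideal
`q` of `B` it is given by `A_{φ⁻¹ q} → B_q`. -/
def comap (φ : A →*₀ B) (U : Opens (MPrime A)) (V : Opens (MPrime B))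
    (h : ∀ q ∈ V, MPrime.comap φ q ∈ U) : Sections U →*₀ Sections V where
  toFun s := ⟨fun q => locMap φ q.1 (s.1 ⟨MPrime.comap φ q.1, h q.1 q.2⟩), fun q => by
    obtain ⟨W, hpW, hW, a, x, e⟩ := s.2 ⟨MPrime.comap φ q.1, h q.1 q.2⟩
    refine ⟨Opens.comap ⟨_, continuous_comap φ⟩ W ⊓ V, ⟨hpW, q.2⟩, inf_le_right, φ a, φ x,
      fun q' hq' => ?_⟩
    obtain ⟨hx, e'⟩ := e _ hq'.1
    exact ⟨hx, (congrArg (locMap φ q') e').trans (locMap_mk φ q' a ⟨x, hx⟩)⟩⟩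
  map_zero' := ext' (fun q => map_zero (locMap φ q.1))
  map_one' := ext' (fun q => map_one (locMap φ q.1))
  map_mul' _ _ := ext' (fun q => map_mul (locMap φ q.1) _ _)

end Sections

end MPrime

/-- `s` is invertible in a neighbourhood of `x`, i.e. the germ of `s` at `x` is a unit of the
stalk at `x`. -/
def IsUnitAt {X : TopCat.{u}} (F : X.Presheaf PtdMon.{u}) {U : Opens X} (s : F.obj (op U))
    (x : X) : Prop :=
  ∃ (W : Opens X) (i : W ⟶ U), x ∈ W ∧ IsUnit (F.map i.op s)

/-- A monoid space: a topological space with a sheaf of pointed monoids. -/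
structure MonoidSpace : Type (u + 1) extends SheafedSpace PtdMon.{u}

namespace MonoidSpace

instance : CoeSort MonoidSpace.{u} (Type u) := ⟨fun X => X.carrier⟩

/-- A morphism of monoid spaces: a continuous map together with a morphism of sheaves such that
the induced maps on stalks are local, i.e. if the image of a germ in `𝒜_{X,x}` is a unit, then
the germ is a unit of `𝒜_{Y,f(x)}`. -/
structure Hom (X Y : MonoidSpace.{u}) extends
    PresheafedSpace.Hom X.toPresheafedSpace Y.toPresheafedSpace where
  isLocal : ∀ (x : X) (V : Opens Y) (s : Y.presheaf.obj (op V)), base x ∈ V →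
    IsUnitAt X.presheaf (U := (Opens.map base).obj V) (c.app (op V) s) x →
    IsUnitAt Y.presheaf s (base x)

theorem ext_toHom {X Y : MonoidSpace.{u}} {f g : Hom X Y} (h : f.toHom = g.toHom) : f = g := by
  cases f; cases g; congr

instance : Category MonoidSpace.{u} where
  Hom := Hom
  id X :=
    { toHom := 𝟙 X.toPresheafedSpace
      isLocal := fun _ _ _ _ h => h }
  comp f g :=
    { toHom := f.toHom.toPshHom ≫ g.toHom.toPshHom
      isLocal := fun x V s hx h => g.isLocal (f.base x) V s hx
        (f.isLocal x ((Opens.map g.base).obj V) (g.c.app (op V) s) hx h) }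
  id_comp f := ext_toHom (Category.id_comp f.toHom.toPshHom)
  comp_id f := ext_toHom (Category.comp_id f.toHom.toPshHom)
  assoc f g h := ext_toHom (Category.assoc f.toHom.toPshHom g.toHom.toPshHom h.toHom.toPshHom)

end MonoidSpace

namespace MPrime

variable (A : Type u) [CommMonoidWithZero A]

/-- The structure sheaf of the prime spectrum, as a presheaf. -/
def structurePresheaf : (TopCat.of (MPrime A)).Presheaf PtdMon.{u} where
  obj U := PtdMon.of (Sections U.unop)
  map i := Sections.res (leOfHom i.unop)
  map_id _ := rfl
  map_comp _ _ := rfl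

theorem structurePresheaf_isSheaf : (structurePresheaf A).IsSheaf := by
  intro E U S hS x hx
  have cov : ∀ p : U, ∃ (V : Opens (MPrime A)) (i : V ⟶ U), S.arrows i ∧ p.1 ∈ V :=
    fun p => hS p.1 p.2
  choose V i hi hpV using cov
  let y : ∀ (V : Opens (MPrime A)) (j : V ⟶ U), S.arrows j → (E →*₀ Sections V) :=
    fun V j hj => x j hj
  have key : ∀ (V W : Opens (MPrime A)) (j : V ⟶ U) (l : W ⟶ U) (hj : S.arrows j)
      (hl : S.arrows l) (e : E) (p : MPrime A) (hpV : p ∈ V) (hpW : p ∈ W),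
      (y V j hj e).val ⟨p, hpV⟩ = (y W l hl e).val ⟨p, hpW⟩ := by
    intro V W j l hj hl e p hpV hpW
    have h := hx (Z := V ⊓ W) (homOfLE inf_le_left) (homOfLE inf_le_right) hj hl rfl
    have h' := congrArg (fun f : E →*₀ Sections (V ⊓ W) => (f e).val ⟨p, hpV, hpW⟩) h
    exact h'
  let g : E →*₀ Sections U :=
    { toFun := fun e => ⟨fun p => (y _ (i p) (hi p) e).val ⟨p.1, hpV p⟩, fun p => by
        obtain ⟨W, hpW, hW, a, t, h⟩ := (y _ (i p) (hi p) e).property ⟨p.1, hpV p⟩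
        refine ⟨W, hpW, hW.trans (leOfHom (i p)), a, t, fun q hq => ?_⟩
        obtain ⟨ht, h⟩ := h q hq
        exact ⟨ht, (key _ _ (i ⟨q, _⟩) (i p) (hi _) (hi p) e q (hpV ⟨q, _⟩) (hW hq)).trans h⟩⟩
      map_zero' := Sections.ext' fun p => by
        change (y _ (i p) (hi p) 0).val ⟨p.1, hpV p⟩ = 0
        rw [map_zero]; rfl
      map_one' := Sections.ext' fun p => by
        change (y _ (i p) (hi p) 1).val ⟨p.1, hpV p⟩ = 1
        rw [map_one]; rfl
      map_mul' := fun a b => Sections.ext' fun p => by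
        change (y _ (i p) (hi p) (a * b)).val ⟨p.1, hpV p⟩ = _
        rw [map_mul]; rfl }
  refine ⟨g, fun W j hj => ?_, fun g' hg' => ?_⟩
  · refine DFunLike.ext (F := E →*₀ Sections W) _ _ fun e => Sections.ext' fun p => ?_
    exact key _ _ _ _ _ _ e p.1 _ _
  · refine DFunLike.ext (F := E →*₀ Sections U) _ _ fun e => Sections.ext' fun p => ?_
    have h := hg' (i p) (hi p)
    exact congrArg (fun f : E →*₀ Sections (V p) => (f e).val ⟨p.1, hpV p⟩) h

end MPrime

/-- The spectrum of a pointed monoid, as a monoid space. -/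
def MSpec (A : Type u) [CommMonoidWithZero A] : MonoidSpace.{u} where
  carrier := TopCat.of (MPrime A)
  presheaf := MPrime.structurePresheaf A
  IsSheaf := MPrime.structurePresheaf_isSheaf A

namespace MSpec

variable {A B : Type u} [CommMonoidWithZero A] [CommMonoidWithZero B]

theorem isUnit_mk_iff (p : MPrime A) (a : A) (t : p.compl) :
    IsUnit (Localization.mk a t) ↔ a ∈ p.compl := by
  constructor
  · rintro h ha
    obtain ⟨y, hy⟩ := isUnit_iff_exists_inv.1 h
    induction y using Localization.induction_on with | H y => ?_
    rw [Localization.mk_mul, ← Localization.mk_one, Localization.mk_eq_mk_iff,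
      Localization.r_iff_exists] at hy
    obtain ⟨c, hc⟩ := hy
    refine p.compl.mul_mem c.2 (p.compl.mul_mem (t * y.2).2 p.compl.one_mem) ?_
    rw [← hc, mul_comm a]
    exact p.mul_mem _ _ (p.mul_mem _ _ (p.mul_mem _ _ ha))
  · intro ha
    refine isUnit_iff_exists_inv.2 ⟨Localization.mk t ⟨a, ha⟩, ?_⟩
    rw [Localization.mk_mul, ← Localization.mk_one, Localization.mk_eq_mk_iff,
      Localization.r_iff_exists]
    exact ⟨1, by simp [mul_comm]⟩

theorem isUnit_of_locMap (φ : A →*₀ B) (q : MPrime B) (x : Localization (q.comap φ).compl)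
    (h : IsUnit (q.locMap φ x)) : IsUnit x := by
  induction x using Localization.induction_on with | H y => ?_
  rw [MPrime.locMap_mk, isUnit_mk_iff] at h
  rwa [isUnit_mk_iff]

/-- A section of the structure sheaf is invertible near `p` if and only if its germ at `p` is a
unit of the localization `A_p`. -/
theorem isUnitAt_iff {U : Opens (MPrime A)} (s : MPrime.Sections U) (p : MPrime A) (hp : p ∈ U) :
    IsUnitAt (MPrime.structurePresheaf A) (U := U) s p ↔ IsUnit (s.val ⟨p, hp⟩) := by
  constructor
  · rintro ⟨W, i, hpW, h⟩
    obtain ⟨y, hy⟩ := isUnit_iff_exists_inv.1 h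
    exact isUnit_iff_exists_inv.2 ⟨MPrime.Sections.val y ⟨p, hpW⟩,
      congrArg (fun z : MPrime.Sections W => z.val ⟨p, hpW⟩) hy⟩
  · intro h
    obtain ⟨W, hpW, hW, a, t, e⟩ := s.property ⟨p, hp⟩
    obtain ⟨ht, e'⟩ := e p hpW
    rw [e', isUnit_mk_iff] at h
    have hW' : W ⊓ MPrime.basicOpen a ≤ U := inf_le_left.trans hW
    refine ⟨W ⊓ MPrime.basicOpen a, homOfLE hW', ⟨hpW, h⟩, ?_⟩
    let z : MPrime.Sections (W ⊓ MPrime.basicOpen a) :=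
      ⟨fun q => Localization.mk t ⟨a, q.2.2⟩, fun q => ⟨_, q.2, le_rfl, t, a, fun q' hq' =>
        ⟨hq'.2, rfl⟩⟩⟩
    refine isUnit_iff_exists_inv.2 ⟨z, MPrime.Sections.ext' fun q => ?_⟩
    obtain ⟨hx, e'⟩ := e q.1 q.2.1
    change s.val ⟨q.1, hW q.2.1⟩ * Localization.mk t ⟨a, q.2.2⟩ = 1
    rw [e', Localization.mk_mul, ← Localization.mk_one, Localization.mk_eq_mk_iff,
      Localization.r_iff_exists]
    exact ⟨1, by simp [mul_comm]⟩

/-- The morphism `MSpec B → MSpec A` induced by a morphism of pointed monoids `A → B`. -/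
def map (φ : A →*₀ B) : MSpec B ⟶ MSpec A where
  base := TopCat.ofHom ⟨MPrime.comap φ, MPrime.continuous_comap φ⟩
  c :=
    { app := fun U => MPrime.Sections.comap φ U.unop
        ((Opens.map (TopCat.ofHom ⟨MPrime.comap φ, MPrime.continuous_comap φ⟩)).obj U.unop)
        fun _ h => h
      naturality := fun _ _ _ => rfl }
  isLocal q U s hq h := by
    refine (isUnitAt_iff s _ hq).2 ?_
    replace h := (isUnitAt_iff _ q hq).1 h
    change IsUnit (MPrime.locMap φ q (s.val ⟨MPrime.comap φ q, hq⟩)) at h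
    exact isUnit_of_locMap φ q _ h

end MSpec

namespace MonoidSpace

/-- The restriction of a monoid space to an open subset. -/
def restrict (X : MonoidSpace.{u}) (U : Opens X) : MonoidSpace.{u} where
  toSheafedSpace := X.toSheafedSpace.restrict U.isOpenEmbedding

/-- A monoid space is an affine monoid scheme if it is isomorphic to the spectrum of a pointed
monoid. -/
def IsAffine (X : MonoidSpace.{u}) : Prop := ∃ A : PtdMon.{u}, Nonempty (X ≅ MSpec A)

/-- An open subset of a monoid space is affine if the restriction to it is an affine monoid
scheme. -/
def IsAffineOpen (X : MonoidSpace.{u}) (U : Opens X) : Prop := (X.restrict U).IsAffine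

/-- A monoid space is a monoid scheme if every point has an affine open neighbourhood. -/
class IsMonoidScheme (X : MonoidSpace.{u}) : Prop where
  exists_isAffineOpen : ∀ x : X, ∃ U : Opens X, x ∈ U ∧ X.IsAffineOpen U

end MonoidSpace

namespace PtdMon

theorem isIso_of_bijective {A B : PtdMon.{u}} (f : A ⟶ B)
    (hf : Function.Bijective (f : A → B)) : IsIso f := by
  let e : A ≃* B := MulEquiv.ofBijective (ConcreteCategory.hom f) hf
  let g : B →*₀ A :=
    { toFun := e.symm
      map_zero' := hf.1 ((e.apply_symm_apply 0).trans (map_zero (ConcreteCategory.hom f)).symm)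
      map_one' := map_one e.symm
      map_mul' := map_mul e.symm }
  refine ⟨g, ?_, ?_⟩
  · exact DFunLike.ext (F := A →*₀ A) _ _ e.symm_apply_apply
  · exact DFunLike.ext (F := B →*₀ B) _ _ e.apply_symm_apply

theorem bijective_of_isIso {A B : PtdMon.{u}} (f : A ⟶ B) [IsIso f] :
    Function.Bijective (f : A → B) := by
  refine Function.bijective_iff_has_inverse.2 ⟨inv f, fun a => ?_, fun b => ?_⟩
  · exact congrArg (fun g : A ⟶ A => g a) (IsIso.hom_inv_id f)
  · exact congrArg (fun g : B ⟶ B => g b) (IsIso.inv_hom_id f)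

end PtdMon

namespace MonoidSpace

theorem isUnitAt_map {X Y : PresheafedSpace.{u} PtdMon.{u}} (f : X ⟶ Y) (x : X) {V : Opens Y}
    (s : Y.presheaf.obj (op V)) (h : IsUnitAt Y.presheaf s (f.base x)) :
    IsUnitAt X.presheaf (U := (Opens.map f.base).obj V) (f.c.app (op V) s) x := by
  obtain ⟨W, i, hxW, h⟩ := h
  refine ⟨(Opens.map f.base).obj W, (Opens.map f.base).map i, hxW, ?_⟩
  have e := congrArg (fun g : Y.presheaf.obj (op V) ⟶ _ => g s) (f.c.naturality i.op)
  change f.c.app (op W) (Y.presheaf.map i.op s) = X.presheaf.map ((Opens.map f.base).map i).op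
    (f.c.app (op V) s) at e
  rw [← e]
  exact h.map (ConcreteCategory.hom (f.c.app (op W)))

theorem isUnitAt_of_eq_id {Y : PresheafedSpace.{u} PtdMon.{u}} (f : Y ⟶ Y) (hf : f = 𝟙 Y) (y : Y)
    {V : Opens Y} (s : Y.presheaf.obj (op V))
    (h : IsUnitAt Y.presheaf (U := (Opens.map f.base).obj V) (f.c.app (op V) s) y) :
    IsUnitAt Y.presheaf s y := by
  subst hf
  exact h

/-- An isomorphism of presheafed spaces between monoid spaces, as an isomorphism of monoid
spaces. -/
def isoMk {X Y : MonoidSpace.{u}} (e : X.toPresheafedSpace ≅ Y.toPresheafedSpace) : X ≅ Y :=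
  have aux : ∀ {X Y : MonoidSpace.{u}} (e : X.toPresheafedSpace ≅ Y.toPresheafedSpace)
      (x : X) (V : Opens Y) (s : Y.presheaf.obj (op V)), e.hom.base x ∈ V →
      IsUnitAt X.presheaf (U := (Opens.map e.hom.base).obj V) (e.hom.c.app (op V) s) x →
      IsUnitAt Y.presheaf s (e.hom.base x) := by
    intro X Y e x V s _ h
    refine isUnitAt_of_eq_id _ e.inv_hom_id _ s ?_
    refine isUnitAt_map e.inv (e.hom.base x) (V := (Opens.map e.hom.base).obj V) _ ?_
    have hx : e.inv.base (e.hom.base x) = x :=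
      congrArg (fun f : X.toPresheafedSpace ⟶ X.toPresheafedSpace => f.base x) e.hom_inv_id
    rwa [hx]
  { hom := ⟨e.hom, aux e⟩
    inv := ⟨e.inv, aux e.symm⟩
    hom_inv_id := ext_toHom e.hom_inv_id
    inv_hom_id := ext_toHom e.inv_hom_id }

/-- The isomorphism of presheafed spaces underlying an isomorphism of monoid spaces. -/
def presheafedIso {X Y : MonoidSpace.{u}} (e : X ≅ Y) :
    X.toPresheafedSpace ≅ Y.toPresheafedSpace where
  hom := e.hom.toHom
  inv := e.inv.toHom
  hom_inv_id := congrArg Hom.toHom e.hom_inv_id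
  inv_hom_id := congrArg Hom.toHom e.inv_hom_id

theorem isAffineOpen_iff {X : MonoidSpace.{u}} {U : Opens X} :
    X.IsAffineOpen U ↔ ∃ (A : PtdMon.{u})
      (g : (MSpec A).toPresheafedSpace ⟶ X.toPresheafedSpace),
      PresheafedSpace.IsOpenImmersion g ∧ Set.range g.base = U := by
  constructor
  · rintro ⟨A, ⟨e⟩⟩
    refine ⟨A, (presheafedIso e).inv ≫ X.toPresheafedSpace.ofRestrict U.isOpenEmbedding,
      ?_, ?_⟩
    · exact @PresheafedSpace.IsOpenImmersion.comp _ _ _ _ _ inferInstance _ _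
        (PresheafedSpace.IsOpenImmersion.ofRestrict X.toPresheafedSpace U.isOpenEmbedding)
    have : Function.Surjective (presheafedIso e).inv.base := fun x =>
      ⟨(presheafedIso e).hom.base x,
        congrArg (fun f : (X.restrict U).toPresheafedSpace ⟶ (X.restrict U).toPresheafedSpace =>
          f.base x) (presheafedIso e).hom_inv_id⟩
    refine (this.range_comp (Subtype.val : U → X)).trans ?_
    exact Subtype.range_coe
  · rintro ⟨A, g, hg, h⟩
    have : PresheafedSpace.IsOpenImmersion (X := (X.restrict U).toPresheafedSpace)
        (X.toPresheafedSpace.ofRestrict U.isOpenEmbedding) :=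
      PresheafedSpace.IsOpenImmersion.ofRestrict X.toPresheafedSpace U.isOpenEmbedding
    refine ⟨A, ⟨isoMk (PresheafedSpace.IsOpenImmersion.isoOfRangeEq
      (X.toPresheafedSpace.ofRestrict U.isOpenEmbedding) g (Subtype.range_coe.trans h.symm))⟩⟩

end MonoidSpace

namespace MSpec

variable {B : Type u} [CommMonoidWithZero B] (s : B)

/-- The localization map `B → B[1/s]`. -/
def away : B →*₀ Localization (Submonoid.powers s) where
  toFun b := Localization.mk b 1
  map_zero' := Localization.mk_zero _
  map_one' := Localization.mk_one
  map_mul' a b := by rw [Localization.mk_mul, one_mul]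

variable {s}

theorem mk_eq (b : B) (t : Submonoid.powers s) :
    (Localization.mk b t : Localization (Submonoid.powers s)) * away s t = away s b := by
  change Localization.mk b t * Localization.mk (t : B) 1 = Localization.mk b 1
  rw [Localization.mk_mul, Localization.mk_eq_mk_iff, Localization.r_iff_exists]
  exact ⟨1, by simp [mul_comm]⟩

theorem away_eq_iff (a b : B) : away s a = away s b ↔ ∃ n : ℕ, s ^ n * a = s ^ n * b := by
  change Localization.mk a 1 = Localization.mk b 1 ↔ _
  rw [Localization.mk_eq_mk_iff, Localization.r_iff_exists]
  constructor
  · rintro ⟨⟨_, n, rfl⟩, h⟩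
    exact ⟨n, by simpa using h⟩
  · rintro ⟨n, h⟩
    exact ⟨⟨s ^ n, n, rfl⟩, by simpa using h⟩

theorem away_mem_compl (q : MPrime (Localization (Submonoid.powers s)))
    (t : Submonoid.powers s) : away s t ∈ q.compl := by
  intro h
  refine q.one_notMem ?_
  have : (Localization.mk 1 t : Localization (Submonoid.powers s)) * away s t = 1 := by
    rw [mk_eq, map_one]
  rw [← this]
  exact q.mul_mem _ _ h

theorem mk_mem_iff (q : MPrime (Localization (Submonoid.powers s))) (b : B)
    (t : Submonoid.powers s) : Localization.mk b t ∈ q.carrier ↔ away s b ∈ q.carrier := by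
  rw [← mk_eq b t]
  constructor
  · intro h
    rw [mul_comm]
    exact q.mul_mem _ _ h
  · intro h
    exact (q.mem_or_mem _ _ h).resolve_right (away_mem_compl q t)

theorem comap_away_injective : Function.Injective (MPrime.comap (away s)) := by
  intro q q' h
  ext x
  induction x using Localization.induction_on with | H y => ?_
  rw [mk_mem_iff, mk_mem_iff]
  exact Set.ext_iff.1 (congrArg MPrime.carrier h) y.1

/-- The prime ideal of `B[1/s]` generated by a prime ideal of `B` not containing `s`. -/
def extend (p : MPrime B) (hp : s ∈ p.compl) : MPrime (Localization (Submonoid.powers s)) where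
  carrier := {x | ∃ b ∈ p.carrier, ∃ t, x = Localization.mk b t}
  zero_mem := ⟨0, p.zero_mem, 1, (Localization.mk_zero _).symm⟩
  mul_mem x y := by
    rintro ⟨b, hb, t, rfl⟩
    induction x using Localization.induction_on with | H y => ?_
    exact ⟨y.1 * b, p.mul_mem _ _ hb, y.2 * t, Localization.mk_mul ..⟩
  one_notMem := by
    rintro ⟨b, hb, t, h⟩
    rw [← Localization.mk_one, Localization.mk_eq_mk_iff, Localization.r_iff_exists] at h
    obtain ⟨c, h⟩ := h
    have hs : ∀ c : Submonoid.powers s, (c : B) ∈ p.compl := fun c =>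
      (Submonoid.powers_le.2 hp) c.2
    refine p.compl.mul_mem (hs c) (p.compl.mul_mem (hs t) p.compl.one_mem) ?_
    rw [h]
    exact p.mul_mem _ _ (p.mul_mem _ _ hb)
  mem_or_mem x y := by
    rintro ⟨b, hb, t, h⟩
    induction x, y using Localization.induction_on₂ with | H x y => ?_
    rw [Localization.mk_mul, Localization.mk_eq_mk_iff, Localization.r_iff_exists] at h
    obtain ⟨c, h⟩ := h
    have hs : ∀ c : Submonoid.powers s, (c : B) ∈ p.compl := fun c =>
      (Submonoid.powers_le.2 hp) c.2
    have h1 : (c : B) * (t * (x.1 * y.1)) ∈ p.carrier := by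
      rw [h]
      exact p.mul_mem _ _ (p.mul_mem _ _ hb)
    have h2 := (p.mem_or_mem _ _ ((p.mem_or_mem _ _ h1).resolve_left (hs c))).resolve_left (hs t)
    exact (p.mem_or_mem _ _ h2).imp (fun h => ⟨_, h, _, rfl⟩) (fun h => ⟨_, h, _, rfl⟩)

theorem comap_extend (p : MPrime B) (hp : s ∈ p.compl) :
    MPrime.comap (away s) (extend p hp) = p := by
  ext b
  constructor
  · rintro ⟨a, ha, t, h⟩
    change Localization.mk b 1 = _ at h
    rw [Localization.mk_eq_mk_iff, Localization.r_iff_exists] at h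
    obtain ⟨c, h⟩ := h
    have hs : ∀ c : Submonoid.powers s, (c : B) ∈ p.compl := fun c =>
      (Submonoid.powers_le.2 hp) c.2
    have h1 : (c : B) * (t * b) ∈ p.carrier := by
      rw [h]
      exact p.mul_mem _ _ (p.mul_mem _ _ ha)
    exact (p.mem_or_mem _ _ ((p.mem_or_mem _ _ h1).resolve_left (hs c))).resolve_left (hs t)
  · intro hb
    exact ⟨b, hb, 1, rfl⟩

theorem range_comap_away : Set.range (MPrime.comap (away s)) = MPrime.basicOpen s := by
  ext p
  constructor
  · rintro ⟨q, rfl⟩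
    exact away_mem_compl q ⟨s, Submonoid.mem_powers s⟩
  · intro hp
    exact ⟨extend p hp, comap_extend p hp⟩

theorem isOpenEmbedding_comap_away : Topology.IsOpenEmbedding (MPrime.comap (away s)) := by
  refine .of_continuous_injective_isOpenMap (MPrime.continuous_comap _) comap_away_injective ?_
  rintro U hU _ ⟨q, hq, rfl⟩
  obtain ⟨c, hc, hU⟩ := hU q hq
  induction c using Localization.induction_on with | H y => ?_
  have hc' : away s y.1 ∈ q.compl := fun h => hc ((mk_mem_iff _ _ _).2 h)
  refine ⟨s * y.1, (q.comap (away s)).compl.mul_mem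
    (away_mem_compl q ⟨s, Submonoid.mem_powers s⟩) hc', fun p hp => ?_⟩
  have hsp : s ∈ p.compl := fun h => hp (by rw [mul_comm]; exact p.mul_mem _ _ h)
  have hyp : y.1 ∈ p.compl := fun h => hp (p.mul_mem _ _ h)
  refine ⟨extend p hsp, hU _ fun h => ?_, comap_extend p hsp⟩
  rw [mk_mem_iff] at h
  exact hyp ((Set.ext_iff.1 (congrArg MPrime.carrier (comap_extend p hsp)) _).1 h)

theorem locMap_away_injective (q : MPrime (Localization (Submonoid.powers s))) :
    Function.Injective (q.locMap (away s)) := by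
  intro x y h
  induction x, y using Localization.induction_on₂ with | H x y => ?_
  rw [MPrime.locMap_mk, MPrime.locMap_mk, Localization.mk_eq_mk_iff,
    Localization.r_iff_exists] at h
  obtain ⟨⟨c, hc⟩, h⟩ := h
  induction c using Localization.induction_on with | H z => ?_
  have hz : away s z.1 ∈ q.compl := fun h => hc ((mk_mem_iff _ _ _).2 h)
  have h' : away s (z.1 * (y.2 * x.1)) = away s (z.1 * (x.2 * y.1)) := by
    simp only [map_mul, ← mk_eq z.1 z.2] at h ⊢
    simpa only [mul_right_comm _ (away s z.2)] using congrArg (· * away s z.2) h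
  obtain ⟨n, hn⟩ := (away_eq_iff _ _).1 h'
  rw [Localization.mk_eq_mk_iff, Localization.r_iff_exists]
  refine ⟨⟨s ^ n * z.1, (q.comap (away s)).compl.mul_mem (away_mem_compl q ⟨_, n, rfl⟩) hz⟩, ?_⟩
  simpa only [mul_assoc] using hn

theorem locMap_away_mk (q : MPrime (Localization (Submonoid.powers s))) (b c : B)
    (t v : Submonoid.powers s) (h : Localization.mk c v ∈ q.compl) (h' : c * t ∈ (q.comap (away s)).compl) :
    q.locMap (away s) (Localization.mk (b * v) ⟨c * t, h'⟩) =
      Localization.mk (Localization.mk b t) ⟨Localization.mk c v, h⟩ := by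
  rw [MPrime.locMap_mk, Localization.mk_eq_mk_iff, Localization.r_iff_exists]
  refine ⟨1, ?_⟩
  simp only [map_mul, ← mk_eq b t, ← mk_eq c v]
  generalize (Localization.mk b t : Localization (Submonoid.powers s)) = x
  generalize (Localization.mk c v : Localization (Submonoid.powers s)) = y
  rw [OneMemClass.coe_one, one_mul, one_mul]
  simp only [mul_comm, mul_left_comm]

theorem comap_away_bijective (U : Opens (MPrime B))
    (V : Opens (MPrime (Localization (Submonoid.powers s))))
    (h : ∀ q, q ∈ V ↔ MPrime.comap (away s) q ∈ U)
    (hU : ∀ p ∈ U, s ∈ p.compl) :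
    Function.Bijective (MPrime.Sections.comap (away s) U V fun q hq => (h q).1 hq) := by
  constructor
  · intro x y hxy
    refine MPrime.Sections.ext' fun ⟨p, hp⟩ => ?_
    obtain ⟨q, rfl⟩ : ∃ q, MPrime.comap (away s) q = p := ⟨_, comap_extend p (hU p hp)⟩
    exact locMap_away_injective q
      (congrArg (fun z : MPrime.Sections V => z.val ⟨q, (h q).2 hp⟩) hxy)
  · intro y
    have key : ∀ (q : MPrime (Localization (Submonoid.powers s))) (hq : q ∈ V),
        ∃ x : Localization (q.comap (away s)).compl, q.locMap (away s) x = y.val ⟨q, hq⟩ := by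
      intro q hq
      obtain ⟨W, hqW, hW, c, d, e⟩ := y.property ⟨q, hq⟩
      obtain ⟨hd, e⟩ := e q hqW
      rw [e]
      induction c, d using Localization.induction_on₂ with | H c d => ?_
      have hd' : away s d.1 ∈ q.compl := fun h => hd ((mk_mem_iff _ _ _).2 h)
      exact ⟨_, locMap_away_mk q c.1 d.1 c.2 d.2 hd
        ((q.comap (away s)).compl.mul_mem hd' (away_mem_compl q c.2))⟩
    have key' : ∀ p : U, ∃ x : Localization p.1.compl, ∀ (q : MPrime _) (hq : q ∈ V)
        (hpq : MPrime.comap (away s) q = p.1), q.locMap (away s) (hpq ▸ x) = y.val ⟨q, hq⟩ := by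
      rintro ⟨p, hp⟩
      obtain ⟨q, rfl⟩ : ∃ q, MPrime.comap (away s) q = p := ⟨_, comap_extend p (hU p hp)⟩
      obtain ⟨x, hx⟩ := key q ((h q).2 hp)
      refine ⟨x, fun q' hq' hqq' => ?_⟩
      obtain rfl := comap_away_injective hqq'
      exact hx
    choose x hx using key'
    refine ⟨⟨x, ?_⟩, MPrime.Sections.ext' fun q => hx ⟨_, (h _).1 q.2⟩ q.1 q.2 rfl⟩
    rintro ⟨p, hp⟩
    obtain ⟨q, rfl⟩ : ∃ q, MPrime.comap (away s) q = p := ⟨_, comap_extend p (hU p hp)⟩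
    obtain ⟨W, hqW, hW, c, d, e⟩ := y.property ⟨q, (h q).2 hp⟩
    induction c, d using Localization.induction_on₂ with | H c d => ?_
    let W' : Opens (MPrime B) := ⟨_, isOpenEmbedding_comap_away.isOpenMap _ W.isOpen⟩
    refine ⟨W', ⟨q, hqW, rfl⟩, ?_, c.1 * d.2, d.1 * c.2, ?_⟩
    · rintro _ ⟨q', hq', rfl⟩
      exact (h q').1 (hW hq')
    · rintro _ ⟨q', hq', rfl⟩
      obtain ⟨hd, e⟩ := e q' hq'
      have hd' : away s d.1 ∈ q'.compl := fun h => hd ((mk_mem_iff _ _ _).2 h)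
      have hd'' := (q'.comap (away s)).compl.mul_mem hd' (away_mem_compl q' c.2)
      refine ⟨hd'', locMap_away_injective q' ?_⟩
      rw [locMap_away_mk q' c.1 d.1 c.2 d.2 hd hd'', ← e]
      exact hx ⟨_, (h _).1 (hW hq')⟩ q' (hW hq') rfl

/-- The morphism `MSpec B[1/s] → MSpec B` is an open immersion. -/
theorem isOpenImmersion_away :
    PresheafedSpace.IsOpenImmersion (map (away s)).toHom.toPshHom where
  base_open := isOpenEmbedding_comap_away
  c_iso U := by
    refine PtdMon.isIso_of_bijective _ (comap_away_bijective _ _ (fun q => Iff.rfl) ?_)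
    rintro _ ⟨q, -, rfl⟩
    exact away_mem_compl q ⟨s, Submonoid.mem_powers s⟩

end MSpec

namespace MPrime

variable {B : Type u} [CommMonoidWithZero B]

/-- The section `b / 1` of the structure sheaf. -/
def toSections (U : Opens (MPrime B)) : B →*₀ Sections U where
  toFun b := ⟨fun p => Localization.mk b 1, fun p => ⟨U, p.2, le_rfl, b, 1, fun q _ =>
    ⟨q.compl.one_mem, rfl⟩⟩⟩
  map_zero' := Sections.ext' fun _ => Localization.mk_zero _
  map_one' := Sections.ext' fun _ => Localization.mk_one
  map_mul' a b := Sections.ext' fun p => by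
    change Localization.mk (a * b) 1 = Localization.mk a 1 * Localization.mk b 1
    rw [Localization.mk_mul, one_mul]

/-- The largest prime ideal not containing `s`. -/
def root (s : B) (p : MPrime B) (hp : s ∈ p.compl) : MPrime B where
  carrier := {b | ∀ (n : ℕ) (c : B), b * c ≠ s ^ n}
  zero_mem n c h := p.compl.pow_mem hp n (by rw [← h, zero_mul]; exact p.zero_mem)
  mul_mem a b hb n c h := hb n (a * c) (by rw [← h]; ac_rfl)
  one_notMem h := h 0 1 (by simp)
  mem_or_mem a b h := by
    by_contra hab
    simp only [Set.mem_ofPred_eq, not_or, not_forall, not_not] at hab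
    obtain ⟨⟨n, c, hc⟩, m, d, hd⟩ := hab
    refine h (n + m) (c * d) ?_
    rw [pow_add, ← hc, ← hd]
    ac_rfl

theorem mem_compl_root (s : B) (p : MPrime B) (hp : s ∈ p.compl) (t : B) :
    t ∈ (root s p hp).compl ↔ ∃ (n : ℕ) (c : B), t * c = s ^ n := by
  change ¬ (∀ (n : ℕ) (c : B), t * c ≠ s ^ n) ↔ _
  simp

theorem root_mem (s : B) (p : MPrime B) (hp : s ∈ p.compl) : root s p hp ∈ basicOpen s :=
  (mem_compl_root s p hp s).2 ⟨1, 1, by simp⟩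

theorem basicOpen_le_of_root_mem (s : B) (p : MPrime B) (hp : s ∈ p.compl)
    (U : Opens (MPrime B)) (h : root s p hp ∈ U) : basicOpen s ≤ U := by
  obtain ⟨t, ht, hU⟩ := U.isOpen _ h
  obtain ⟨n, c, hc⟩ := (mem_compl_root s p hp t).1 ht
  intro q hq
  refine hU q fun htq => q.compl.pow_mem hq n ?_
  rw [← hc, mul_comm]
  exact q.mul_mem _ _ htq

/-- The sections over `D(s)` are the localization `B[1/s]`. -/
theorem isLocalizationMap_toSections (s : B) (p : MPrime B) (hp : s ∈ p.compl) :
    (Submonoid.powers s).IsLocalizationMap (toSections (basicOpen s)) where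
  map_units := by
    rintro ⟨_, n, rfl⟩
    refine isUnit_iff_exists_inv.2 ⟨⟨fun q => Localization.mk 1 ⟨s ^ n, q.1.compl.pow_mem q.2 n⟩,
      fun q => ⟨_, q.2, le_rfl, 1, s ^ n, fun q' hq' => ⟨q'.compl.pow_mem hq' n, rfl⟩⟩⟩,
      Sections.ext' fun q => ?_⟩
    change Localization.mk (s ^ n) 1 * Localization.mk 1 _ = 1
    rw [Localization.mk_mul, ← Localization.mk_one, Localization.mk_eq_mk_iff,
      Localization.r_iff_exists]
    exact ⟨1, by simp [mul_comm]⟩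
  surj y := by
    obtain ⟨W, hpW, hW, a, t, e⟩ := y.property ⟨_, root_mem s p hp⟩
    obtain ⟨ht, -⟩ := e _ hpW
    obtain ⟨n, c, hc⟩ := (mem_compl_root s p hp t).1 ht
    refine ⟨⟨a * c, ⟨s ^ n, n, rfl⟩⟩, Sections.ext' fun q => ?_⟩
    obtain ⟨ht, e⟩ := e q.1 (basicOpen_le_of_root_mem s p hp W hpW q.2)
    change y.val q * Localization.mk (s ^ n) 1 = Localization.mk (a * c) 1
    rw [e, Localization.mk_mul, Localization.mk_eq_mk_iff, Localization.r_iff_exists]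
    refine ⟨1, ?_⟩
    simp only [← hc, OneMemClass.coe_one, mul_one, one_mul]
    ac_rfl
  exists_of_eq {a b} h := by
    have h := congrArg (fun z : Sections (basicOpen s) => z.val ⟨_, root_mem s p hp⟩) h
    change Localization.mk a 1 = Localization.mk b 1 at h
    rw [Localization.mk_eq_mk_iff, Localization.r_iff_exists] at h
    obtain ⟨⟨u, hu⟩, h⟩ := h
    obtain ⟨n, c, hc⟩ := (mem_compl_root s p hp u).1 hu
    refine ⟨⟨s ^ n, n, rfl⟩, ?_⟩
    simp only [OneMemClass.coe_one, one_mul] at h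
    simp only [← hc]
    rw [mul_right_comm, h, mul_right_comm]

theorem toSections_bijective (U : Opens (MPrime B)) (hU : U = ⊤) (p : MPrime B) :
    Function.Bijective (toSections U) := by
  obtain rfl : U = basicOpen 1 := by
    rw [hU]
    ext q
    exact ⟨fun _ => q.compl.one_mem, fun _ => trivial⟩
  have h := isLocalizationMap_toSections 1 p p.compl.one_mem
  constructor
  · intro a b hab
    obtain ⟨⟨_, n, rfl⟩, h⟩ := h.exists_of_eq hab
    simpa using h
  · intro y
    obtain ⟨⟨a, ⟨_, n, rfl⟩⟩, h⟩ := h.surj y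
    exact ⟨a, by simpa using h.symm⟩

end MPrime

/-- The principal open subset `D(s)` of the spectrum. -/
def MSpec.basicOpen {B : Type u} [CommMonoidWithZero B] (s : B) : Opens (MSpec B) :=
  MPrime.basicOpen s

theorem isLocalizationMap_of_bijective {B M N S : Type u} [CommMonoidWithZero B]
    [CommMonoidWithZero M] [CommMonoidWithZero N] [CommMonoidWithZero S] (γ : B →*₀ M)
    (hγ : Function.Bijective γ) (f : M →*₀ N) (h : N →*₀ S) (hh : Function.Bijective h)
    (t : B →*₀ S) (ht : ∀ b, h (f (γ b)) = t b) (s : B)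
    (hloc : (Submonoid.powers s).IsLocalizationMap t) :
    (Submonoid.powers (γ s)).IsLocalizationMap f := by
  have hpow : ∀ n : ℕ, γ s ^ n = γ (s ^ n) := fun n => (map_pow γ s n).symm
  constructor
  · rintro ⟨_, n, rfl⟩
    obtain ⟨y, hy⟩ := isUnit_iff_exists_inv.1 (hloc.map_units ⟨s ^ n, n, rfl⟩)
    obtain ⟨z, rfl⟩ := hh.2 y
    refine isUnit_iff_exists_inv.2 ⟨z, hh.1 ?_⟩
    dsimp only
    rw [map_mul, hpow, ht, map_one]
    exact hy
  · intro y
    obtain ⟨⟨a, ⟨_, n, rfl⟩⟩, e⟩ := hloc.surj (h y)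
    refine ⟨⟨γ a, ⟨γ s ^ n, n, rfl⟩⟩, hh.1 ?_⟩
    dsimp only
    rw [map_mul, hpow, ht, ht]
    exact e
  · intro x y hxy
    obtain ⟨a, rfl⟩ := hγ.2 x
    obtain ⟨b, rfl⟩ := hγ.2 y
    have e := congrArg h hxy
    rw [ht, ht] at e
    obtain ⟨⟨_, n, rfl⟩, e⟩ := hloc.exists_of_eq e
    refine ⟨⟨γ s ^ n, n, rfl⟩, ?_⟩
    dsimp only at e ⊢
    rw [hpow, ← map_mul, ← map_mul, e]

namespace MonoidSpace

variable {X : MonoidSpace.{u}}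

theorem isAffineOpen_image {B : PtdMon.{u}}
    (g : (MSpec B).toPresheafedSpace ⟶ X.toPresheafedSpace) [PresheafedSpace.IsOpenImmersion g]
    (s : B) (W : Opens X) (hW : (W : Set X) = g.base '' MSpec.basicOpen s) :
    X.IsAffineOpen W := by
  have := MSpec.isOpenImmersion_away (s := s)
  refine isAffineOpen_iff.2 ⟨PtdMon.of (Localization (Submonoid.powers s)),
    (MSpec.map (MSpec.away s)).toHom.toPshHom ≫ g, PresheafedSpace.IsOpenImmersion.comp _ _, ?_⟩
  refine (Set.range_comp g.base (MPrime.comap (MSpec.away s))).trans ?_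
  exact (congrArg (g.base '' ·) MSpec.range_comap_away).trans hW.symm

instance (A : Type u) [CommMonoidWithZero A] : (MSpec A).IsMonoidScheme where
  exists_isAffineOpen _ := ⟨⊤, trivial, isAffineOpen_iff.2
    ⟨PtdMon.of A, 𝟙 (MSpec A).toPresheafedSpace, inferInstance, Set.range_id⟩⟩

/-- The affine open subsets of a monoid scheme form a basis of its topology. -/
theorem exists_isAffineOpen_le [X.IsMonoidScheme] (x : X) (U : Opens X) (hx : x ∈ U) :
    ∃ W : Opens X, x ∈ W ∧ X.IsAffineOpen W ∧ W ≤ U := by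
  obtain ⟨V, hxV, hV⟩ := IsMonoidScheme.exists_isAffineOpen x
  obtain ⟨B, g, hg, hV⟩ := isAffineOpen_iff.1 hV
  obtain ⟨p, rfl⟩ : x ∈ Set.range g.base := by rw [hV]; exact hxV
  obtain ⟨s, hs, hsU⟩ := ((Opens.map g.base).obj U).isOpen p hx
  refine ⟨⟨g.base '' MSpec.basicOpen s, hg.base_open.isOpenMap _ (MSpec.basicOpen s).isOpen⟩,
    ⟨p, hs, rfl⟩, isAffineOpen_image g s _ rfl, ?_⟩
  rintro _ ⟨q, hq, rfl⟩
  exact hsU q hq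

/-- A non-empty affine open subset has a point whose only neighbourhood in it is everything. -/
theorem IsAffineOpen.exists_root {U : Opens X} (hU : X.IsAffineOpen U)
    (hne : (U : Set X).Nonempty) : ∃ x ∈ U, ∀ V : Opens X, x ∈ V → U ≤ V := by
  obtain ⟨B, g, hg, hr⟩ := isAffineOpen_iff.1 hU
  obtain ⟨x, hx⟩ := hne
  rw [← hr] at hx
  obtain ⟨p, rfl⟩ := hx
  refine ⟨g.base (MPrime.root 1 p p.compl.one_mem), ?_, fun V hV => ?_⟩
  · change _ ∈ (U : Set X)
    rw [← hr]
    exact ⟨_, rfl⟩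
  · intro y hy
    change y ∈ (U : Set X) at hy
    rw [← hr] at hy
    obtain ⟨q, rfl⟩ := hy
    exact MPrime.basicOpen_le_of_root_mem 1 p p.compl.one_mem ((Opens.map g.base).obj V) hV q.compl.one_mem

theorem IsAffineOpen.exists_eq_image {B : PtdMon.{u}}
    (g : (MSpec B).toPresheafedSpace ⟶ X.toPresheafedSpace) [hg : PresheafedSpace.IsOpenImmersion g]
    {U : Opens X} (hU : X.IsAffineOpen U) (hne : (U : Set X).Nonempty)
    (hUg : (U : Set X) ⊆ Set.range g.base) :
    ∃ s : B, (U : Set X) = g.base '' MSpec.basicOpen s := by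
  obtain ⟨x, hx, hroot⟩ := hU.exists_root hne
  obtain ⟨p, rfl⟩ := hUg hx
  obtain ⟨s, hs, hsU⟩ := ((Opens.map g.base).obj U).isOpen p hx
  refine ⟨s, Set.Subset.antisymm ?_ ?_⟩
  · exact hroot ⟨_, hg.base_open.isOpenMap _ (MSpec.basicOpen s).isOpen⟩ ⟨p, hs, rfl⟩
  · rintro _ ⟨q, hq, rfl⟩
    exact hsU q hq

theorem exists_coordinates {B : PtdMon.{u}}
    (g : (MSpec B).toPresheafedSpace ⟶ X.toPresheafedSpace) [hg : PresheafedSpace.IsOpenImmersion g]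
    (V : Opens X) (hV : Set.range g.base = V) (p : MPrime B) :
    ∃ γ : B →*₀ X.presheaf.obj (op V), Function.Bijective γ ∧
      ∀ (U : Opens X) (i : U ⟶ V) (s : B), (U : Set X) = g.base '' MSpec.basicOpen s →
        (U : Set X).Nonempty → (Submonoid.powers (γ s)).IsLocalizationMap
          (ConcreteCategory.hom (X.presheaf.map i.op)) := by
  have key : ∀ U : Opens X, U ≤ V → IsIso (g.c.app (op U)) := by
    intro U hU
    refine PresheafedSpace.IsOpenImmersion.c_iso' g ((Opens.map g.base).obj U) ?_
    ext x
    constructor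
    · intro hx
      obtain ⟨q, rfl⟩ : x ∈ Set.range g.base := by rw [hV]; exact hU hx
      exact ⟨q, hx, rfl⟩
    · rintro ⟨q, hq, rfl⟩
      exact hq
  have hiso := key V le_rfl
  have htop : (Opens.map g.base).obj V = ⊤ := by
    ext q
    refine ⟨fun _ => trivial, fun _ => ?_⟩
    change g.base q ∈ (V : Set X)
    rw [← hV]
    exact ⟨q, rfl⟩
  let γ : B →*₀ X.presheaf.obj (op V) :=
    (ConcreteCategory.hom (inv (g.c.app (op V)))).comp (MPrime.toSections ((Opens.map g.base).obj V))
  have hγ : ∀ b, g.c.app (op V) (γ b) = MPrime.toSections ((Opens.map g.base).obj V) b := fun b =>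
    congrArg (fun f : (MSpec B).presheaf.obj (op ((Opens.map g.base).obj V)) ⟶ _ =>
      f (MPrime.toSections ((Opens.map g.base).obj V) b)) (IsIso.inv_hom_id (g.c.app (op V)))
  have hγb : Function.Bijective γ :=
    (PtdMon.bijective_of_isIso (inv (g.c.app (op V)))).comp
      (MPrime.toSections_bijective _ htop p)
  refine ⟨γ, hγb, fun U i s hs hne => ?_⟩
  have hiU := key U (leOfHom i)
  have hbU := PtdMon.bijective_of_isIso (g.c.app (op U))
  have hU : (Opens.map g.base).obj U = MPrime.basicOpen s := by
    ext q
    change g.base q ∈ (U : Set X) ↔ _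
    rw [hs]
    exact hg.base_open.injective.mem_set_image
  obtain ⟨p', hp'⟩ : ∃ p', s ∈ MPrime.compl (A := B) p' := by
    rw [hs] at hne
    obtain ⟨_, q, hq, rfl⟩ := hne
    exact ⟨q, hq⟩
  have hcomm : ∀ b, g.c.app (op U) (X.presheaf.map i.op (γ b)) =
      MPrime.toSections ((Opens.map g.base).obj U) b := by
    intro b
    have h := congrArg (fun f : X.presheaf.obj (op V) ⟶ _ => f (γ b)) (g.c.naturality i.op)
    refine h.trans ?_
    exact congrArg ((MSpec B).presheaf.map ((Opens.map g.base).map i).op) (hγ b)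
  let f : X.presheaf.obj (op V) →*₀ X.presheaf.obj (op U) :=
    ConcreteCategory.hom (X.presheaf.map i.op)
  let h : X.presheaf.obj (op U) →*₀ (MSpec B).presheaf.obj (op ((Opens.map g.base).obj U)) :=
    ConcreteCategory.hom (g.c.app (op U))
  refine isLocalizationMap_of_bijective γ hγb f h hbU
    (MPrime.toSections ((Opens.map g.base).obj U)) hcomm s ?_
  have := MPrime.isLocalizationMap_toSections s p' hp'
  rwa [← hU] at this

end MonoidSpace

/-- The ring `k[A]` of a pointed monoid `A`: the free `k`-module on the set `A` modulo the summand
spanned by the base point `0`, with the product extending that of `A`. -/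
def PointedAlgebra (k A : Type u) [CommRing k] [CommMonoidWithZero A] : Type u :=
  MonoidAlgebra k A ⧸ Ideal.span {MonoidAlgebra.single (0 : A) (1 : k)}

namespace PointedAlgebra

variable (k : Type u) [CommRing k] {A B C : Type u} [CommMonoidWithZero A] [CommMonoidWithZero B]
  [CommMonoidWithZero C]

instance : CommRing (PointedAlgebra k A) :=
  inferInstanceAs (CommRing (MonoidAlgebra k A ⧸ Ideal.span {MonoidAlgebra.single (0 : A) (1 : k)}))

/-- The structure map `k → k[A]`. -/
def coeff : k →+* PointedAlgebra k A :=
  (Ideal.Quotient.mk (Ideal.span {MonoidAlgebra.single (0 : A) (1 : k)})).comp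
    (algebraMap k (MonoidAlgebra k A))

/-- The inclusion of `A` in the multiplicative monoid of `k[A]`. -/
def of : A →*₀ PointedAlgebra k A where
  toFun a := Ideal.Quotient.mk _ (MonoidAlgebra.of k A a)
  map_zero' := Ideal.Quotient.eq_zero_iff_mem.2 (Ideal.subset_span rfl)
  map_one' := by rw [map_one, map_one]; rfl
  map_mul' a b := by rw [map_mul, map_mul]; rfl

variable {k} in
/-- The universal property of `k[A]`. -/
def lift {R : Type u} [CommRing R] (ρ : k →+* R) (m : A →*₀ R) : PointedAlgebra k A →+* R :=
  Ideal.Quotient.lift _ (MonoidAlgebra.liftNCRingHom ρ (m : A →* R) fun _ _ => Commute.all _ _) <| by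
    intro x hx
    induction hx using Submodule.span_induction with
    | mem x hx =>
      obtain rfl := hx
      simp [MonoidAlgebra.liftNCRingHom]
    | zero => exact map_zero _
    | add x y _ _ hx hy => rw [map_add, hx, hy, add_zero]
    | smul a x _ hx => rw [smul_eq_mul, map_mul, hx, mul_zero]

theorem lift_of {R : Type u} [CommRing R] (ρ : k →+* R) (m : A →*₀ R) (a : A) :
    lift ρ m (of k a) = m a := by
  refine (Ideal.Quotient.lift_mk _ _ _).trans ?_
  simp [MonoidAlgebra.liftNCRingHom]

theorem lift_coeff {R : Type u} [CommRing R] (ρ : k →+* R) (m : A →*₀ R) (c : k) :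
    lift ρ m (coeff k c) = ρ c := by
  refine (Ideal.Quotient.lift_mk _ _ _).trans ?_
  simp [MonoidAlgebra.liftNCRingHom]

variable {k} in
theorem hom_ext {R : Type u} [CommRing R] {f g : PointedAlgebra k A →+* R}
    (h : ∀ c, f (coeff k c) = g (coeff k c)) (h' : ∀ a, f (of k a) = g (of k a)) : f = g := by
  refine Ideal.Quotient.ringHom_ext (MonoidAlgebra.ringHom_ext (fun c => ?_) fun a => ?_)
  · exact h c
  · exact h' a

/-- The ring map `k[A] → k[B]` induced by a morphism of pointed monoids `A → B`. -/
def map (φ : A →*₀ B) : PointedAlgebra k A →+* PointedAlgebra k B :=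
  lift (coeff k) ((of k).comp φ)

theorem map_of (φ : A →*₀ B) (a : A) : map k φ (of k a) = of k (φ a) := lift_of ..

theorem map_coeff (φ : A →*₀ B) (c : k) : map k φ (coeff k c) = coeff k c := lift_coeff ..

theorem map_id : map k (MonoidWithZeroHom.id A) = RingHom.id _ :=
  hom_ext (fun _ => map_coeff ..) (fun _ => map_of ..)

theorem map_comp (φ : A →*₀ B) (ψ : B →*₀ C) : map k (ψ.comp φ) = (map k ψ).comp (map k φ) :=
  hom_ext (fun _ => by simp [map_coeff]) (fun _ => by simp [map_of])

theorem isLocalization_map (φ : A →*₀ B) (s : A)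
    (h : (Submonoid.powers s).IsLocalizationMap φ) :
    @IsLocalization.Away _ _ (of k s) (PointedAlgebra k B) _ (map k φ).toAlgebra := by
  let := (map k φ).toAlgebra
  let L := Localization.Away (of k s)
  let m : A →* L := (algebraMap (PointedAlgebra k A) L).toMonoidHom.comp ((of k : A →*₀ PointedAlgebra k A) : A →* PointedAlgebra k A)
  have hm : ∀ y : Submonoid.powers s, IsUnit (m y) := by
    rintro ⟨_, n, rfl⟩
    refine IsLocalization.map_units L (⟨of k (s ^ n), n, ?_⟩ : Submonoid.powers (of k s))
    exact (map_pow (of k) s n).symm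
  let e : (Submonoid.powers s).LocalizationMap B := ⟨(φ : A →ₙ* B), h⟩
  have he : ∀ a, e a = φ a := fun _ => rfl
  let m' : B →*₀ L :=
    { e.lift hm with
      map_zero' := by
        have : e.lift hm (e 0) = m 0 := e.lift_eq hm 0
        rw [he, map_zero] at this
        refine this.trans ?_
        change algebraMap (PointedAlgebra k A) L (of k 0) = 0
        rw [map_zero, map_zero] }
  have hm' : ∀ a, m' (φ a) = algebraMap (PointedAlgebra k A) L (of k a) := fun a => e.lift_eq hm a
  let ψ : PointedAlgebra k B →+* L :=
    lift ((algebraMap (PointedAlgebra k A) L).comp (coeff k)) m'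
  have hψ : ∀ x, ψ (map k φ x) = algebraMap (PointedAlgebra k A) L x := by
    intro x
    have : ψ.comp (map k φ) = algebraMap (PointedAlgebra k A) L := by
      refine hom_ext (fun c => ?_) fun a => ?_
      · rw [RingHom.comp_apply, map_coeff]
        exact lift_coeff ..
      · rw [RingHom.comp_apply, map_of]
        exact (lift_of ..).trans (hm' a)
    exact congrArg (fun f : _ →+* L => f x) this
  have hu : IsUnit (map k φ (of k s)) := by
    rw [map_of]
    exact (h.map_units ⟨s, Submonoid.mem_powers s⟩).map (of k)
  let χ : L →+* PointedAlgebra k B := IsLocalization.Away.lift (of k s) hu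
  have hχ : ∀ x, χ (algebraMap _ L x) = map k φ x := fun x => IsLocalization.Away.lift_eq ..
  have h1 : χ.comp ψ = RingHom.id _ := by
    refine hom_ext (fun c => ?_) fun b => ?_
    · rw [RingHom.comp_apply, ← map_coeff k φ, hψ, hχ]; rfl
    · obtain ⟨⟨a, t⟩, hb⟩ := h.surj b
      have ht : IsUnit (of k (φ t)) := (h.map_units t).map (of k)
      refine ht.mul_right_cancel ?_
      have : ∀ x : A, χ.comp ψ (of k (φ x)) = of k (φ x) := fun x => by
        rw [RingHom.comp_apply, ← map_of, hψ, hχ]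
      calc χ.comp ψ (of k b) * of k (φ t) = χ.comp ψ (of k (b * φ t)) := by
            rw [map_mul (of k), map_mul, this]
        _ = of k b * of k (φ t) := by
            rw [hb, this, ← hb, map_mul]
  have h2 : ψ.comp χ = RingHom.id L := by
    refine IsLocalization.ringHom_ext (Submonoid.powers (of k s)) ?_
    ext x
    simp only [RingHom.comp_apply, hχ, hψ, RingHom.id_apply]
  let E : L ≃ₐ[PointedAlgebra k A] PointedAlgebra k B :=
    AlgEquiv.ofRingEquiv (f := RingEquiv.ofRingHom χ ψ h1 h2) hχ
  exact IsLocalization.isLocalization_of_algEquiv _ E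

theorem isOpenImmersion_map (φ : A →*₀ B) (s : A)
    (h : (Submonoid.powers s).IsLocalizationMap φ) :
    IsOpenImmersion (Spec.map (CommRingCat.ofHom (map k φ))) := by
  let := (map k φ).toAlgebra
  have := isLocalization_map k φ s h
  exact IsOpenImmersion.of_isLocalization (R := PointedAlgebra k A) (S := PointedAlgebra k B) (of k s)

theorem range_comap_map (φ : A →*₀ B) (s : A)
    (h : (Submonoid.powers s).IsLocalizationMap φ) :
    Set.range (PrimeSpectrum.comap (map k φ)) = PrimeSpectrum.basicOpen (of k s) := by
  let := (map k φ).toAlgebra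
  have := isLocalization_map k φ s h
  exact PrimeSpectrum.localization_away_comap_range (PointedAlgebra k B) (of k s)

end PointedAlgebra

namespace MonoidSpace

/-- The partially ordered set of non-empty affine open subsets. -/
abbrev AffineOpens (X : MonoidSpace.{u}) : Type u :=
  {U : Opens X // X.IsAffineOpen U ∧ (U : Set X).Nonempty}

/-- The diagram of the affine schemes `U_k = Spec k[𝒜(U)]`, where `U` runs through the non-empty
affine open subsets of `X`, and the morphisms `U_k → V_k` for `U ⊆ V`. -/
def realizationDiagram (k : Type u) [CommRing k] (X : MonoidSpace.{u}) :
    X.AffineOpens ⥤ Scheme.{u} where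
  obj U := Spec (CommRingCat.of (PointedAlgebra k (X.presheaf.obj (op U.1))))
  map {U V} i := Spec.map (CommRingCat.ofHom (PointedAlgebra.map k
    (ConcreteCategory.hom (X.presheaf.map (homOfLE (leOfHom i) : U.1 ⟶ V.1).op))))
  map_id U := by
    have h : X.presheaf.map (homOfLE (leOfHom (𝟙 U)) : U.1 ⟶ U.1).op = 𝟙 _ := X.presheaf.map_id _
    rw [h, ← Spec.map_id]
    congr 1
    refine CommRingCat.hom_ext (PointedAlgebra.map_id k)
  map_comp {U V W} i j := by
    have h : X.presheaf.map (homOfLE (leOfHom (i ≫ j)) : U.1 ⟶ W.1).op =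
      X.presheaf.map (homOfLE (leOfHom j) : V.1 ⟶ W.1).op ≫
        X.presheaf.map (homOfLE (leOfHom i) : U.1 ⟶ V.1).op := by
      rw [← X.presheaf.map_comp]; rfl
    rw [h, ← Spec.map_comp]
    congr 1
    exact CommRingCat.hom_ext (PointedAlgebra.map_comp k _ _)

end MonoidSpace

namespace MonoidSpace

variable (k : Type u) [CommRing k] (X Y : MonoidSpace.{u})

instance {U V : X.AffineOpens} (i : U ⟶ V) :
    IsOpenImmersion ((realizationDiagram k X).map i) := by
  obtain ⟨B, g, hg, hV⟩ := isAffineOpen_iff.1 V.2.1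
  have hUV : U.1 ≤ V.1 := leOfHom i
  obtain ⟨s, hs⟩ := U.2.1.exists_eq_image g U.2.2 (by rw [hV]; exact hUV)
  obtain ⟨p⟩ : Nonempty (MPrime B) := by
    obtain ⟨x, hx⟩ := V.2.2
    rw [← hV] at hx
    obtain ⟨p, -⟩ := hx
    exact ⟨p⟩
  obtain ⟨γ, -, hγ⟩ := exists_coordinates g V.1 hV p
  exact PointedAlgebra.isOpenImmersion_map k _ _ (hγ U.1 (homOfLE hUV) s hs U.2.2)

theorem realizationDiagram_isLocallyDirected :
    (realizationDiagram k X ⋙ Scheme.forget).IsLocallyDirected where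
  cond {U₁ U₂ V} i₁ i₂ P₁ P₂ hP := by
    obtain ⟨B, g, hg, hV⟩ := isAffineOpen_iff.1 V.2.1
    have h₁ : U₁.1 ≤ V.1 := leOfHom i₁
    have h₂ : U₂.1 ≤ V.1 := leOfHom i₂
    obtain ⟨s₁, hs₁⟩ := U₁.2.1.exists_eq_image g U₁.2.2 (by rw [hV]; exact h₁)
    obtain ⟨s₂, hs₂⟩ := U₂.2.1.exists_eq_image g U₂.2.2 (by rw [hV]; exact h₂)
    obtain ⟨p⟩ : Nonempty (MPrime B) := by
      obtain ⟨x, hx⟩ := V.2.2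
      rw [← hV] at hx
      obtain ⟨p, -⟩ := hx
      exact ⟨p⟩
    obtain ⟨γ, -, hγ⟩ := exists_coordinates g V.1 hV p
    let P : PrimeSpectrum (PointedAlgebra k (X.presheaf.obj (op V.1))) :=
      (realizationDiagram k X).map i₁ P₁
    have hP₁ : (realizationDiagram k X).map i₁ P₁ = P := rfl
    have hP₂ : (realizationDiagram k X).map i₂ P₂ = P := hP.symm
    have hsP₁ : P ∈ PrimeSpectrum.basicOpen (PointedAlgebra.of k (γ s₁)) := by
      have := PointedAlgebra.range_comap_map k _ _ (hγ U₁.1 (homOfLE h₁) s₁ hs₁ U₁.2.2)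
      exact this.le ⟨P₁, hP₁⟩
    have hsP₂ : P ∈ PrimeSpectrum.basicOpen (PointedAlgebra.of k (γ s₂)) := by
      have := PointedAlgebra.range_comap_map k _ _ (hγ U₂.1 (homOfLE h₂) s₂ hs₂ U₂.2.2)
      exact this.le ⟨P₂, hP₂⟩
    let q : MPrime B :=
      { carrier := {b | PointedAlgebra.of k (γ b) ∈ P.asIdeal}
        zero_mem := by simp
        mul_mem := fun a b h => by
          change PointedAlgebra.of k (γ (a * b)) ∈ P.asIdeal
          rw [map_mul, map_mul]
          exact P.asIdeal.mul_mem_left _ h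
        one_notMem := by
          intro h
          refine P.2.ne_top (P.asIdeal.eq_top_iff_one.2 ?_)
          change PointedAlgebra.of k (γ 1) ∈ P.asIdeal at h
          rwa [map_one, map_one] at h
        mem_or_mem := fun a b h => by
          change PointedAlgebra.of k (γ (a * b)) ∈ P.asIdeal at h
          rw [map_mul, map_mul] at h
          exact P.2.mem_or_mem h }
    have hq : s₁ * s₂ ∈ q.compl := q.compl.mul_mem hsP₁ hsP₂
    let W : Opens X := ⟨g.base '' MSpec.basicOpen (s₁ * s₂),
      hg.base_open.isOpenMap _ (MSpec.basicOpen (s₁ * s₂)).isOpen⟩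
    have hW : (W : Set X).Nonempty := ⟨_, q, hq, rfl⟩
    have hW₁ : W ≤ U₁.1 := by
      rintro _ ⟨r, hr, rfl⟩
      change g.base r ∈ (U₁.1 : Set X)
      rw [hs₁]
      exact ⟨r, fun h => hr (by rw [mul_comm]; exact r.mul_mem _ _ h), rfl⟩
    have hW₂ : W ≤ U₂.1 := by
      rintro _ ⟨r, hr, rfl⟩
      change g.base r ∈ (U₂.1 : Set X)
      rw [hs₂]
      exact ⟨r, fun h => hr (r.mul_mem _ _ h), rfl⟩
    let l : X.AffineOpens := ⟨W, isAffineOpen_image g (s₁ * s₂) W rfl, hW⟩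
    let l₁ : l ⟶ U₁ := homOfLE hW₁
    let l₂ : l ⟶ U₂ := homOfLE hW₂
    have hPW : P ∈ PrimeSpectrum.basicOpen (PointedAlgebra.of k (γ (s₁ * s₂))) := by
      rw [map_mul, map_mul, PrimeSpectrum.basicOpen_mul]
      exact ⟨hsP₁, hsP₂⟩
    have hr := PointedAlgebra.range_comap_map k _ _
      (hγ W (homOfLE (hW₁.trans h₁)) (s₁ * s₂) rfl hW)
    obtain ⟨Q, hQ⟩ := hr.ge hPW
    have hQ : ∀ j : l ⟶ V, (realizationDiagram k X).map j Q = P := fun _ => hQ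
    refine ⟨l, l₁, l₂, Q, ?_, ?_⟩
    · refine ((realizationDiagram k X).map i₁).isOpenEmbedding.injective ?_
      refine Eq.trans ?_ ((hQ (l₁ ≫ i₁)).trans hP₁.symm)
      rw [Functor.map_comp]; rfl
    · refine ((realizationDiagram k X).map i₂).isOpenEmbedding.injective ?_
      refine Eq.trans ?_ ((hQ (l₂ ≫ i₂)).trans hP₂.symm)
      rw [Functor.map_comp]; rfl

instance : (realizationDiagram k X ⋙ Scheme.forget).IsLocallyDirected :=
  realizationDiagram_isLocallyDirected k X

/-- The `k`-realization `X_k` of a monoid scheme `X`: the scheme obtained by gluing the affine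
schemes `U_k = Spec k[𝒜(U)]`, where `U` runs through the non-empty affine open subsets of `X`. -/
def realization : Scheme.{u} := Limits.colimit (realizationDiagram k X)

/-- The open immersion `U_k → X_k` of an affine open subset `U` of `X`. -/
def realizationι (U : X.AffineOpens) : (realizationDiagram k X).obj U ⟶ realization k X :=
  Limits.colimit.ι (realizationDiagram k X) U

variable {k X Y}

theorem realizationDiagram_map_comp_ι {U V : X.AffineOpens} (i : U ⟶ V) :
    (realizationDiagram k X).map i ≫ realizationι k X V = realizationι k X U :=
  Limits.colimit.w (realizationDiagram k X) i

theorem exists_le_comap [Y.IsMonoidScheme] (f : X ⟶ Y) (U : X.AffineOpens) :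
    ∃ V : Y.AffineOpens, U.1 ≤ (Opens.map f.base).obj V.1 := by
  obtain ⟨x, -, hroot⟩ := U.2.1.exists_root U.2.2
  obtain ⟨V, hxV, hV⟩ := IsMonoidScheme.exists_isAffineOpen (f.base x)
  exact ⟨⟨V, hV, f.base x, hxV⟩, hroot ((Opens.map f.base).obj V) hxV⟩

/-- The morphism `U_k → V_k` induced by a morphism `f : X → Y` with `f(U) ⊆ V`. -/
def realizationMapAffine (k : Type u) [CommRing k] (f : X ⟶ Y) (U : X.AffineOpens)
    (V : Y.AffineOpens) (h : U.1 ≤ (Opens.map f.base).obj V.1) :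
    (realizationDiagram k X).obj U ⟶ (realizationDiagram k Y).obj V :=
  Spec.map (CommRingCat.ofHom (PointedAlgebra.map k
    (ConcreteCategory.hom (f.c.app (op V.1) ≫ X.presheaf.map (homOfLE h).op))))

theorem realizationDiagram_map_comp_mapAffine (f : X ⟶ Y) {U U' : X.AffineOpens} (i : U' ⟶ U)
    (V : Y.AffineOpens) (h : U.1 ≤ (Opens.map f.base).obj V.1) :
    (realizationDiagram k X).map i ≫ realizationMapAffine k f U V h =
      realizationMapAffine k f U' V (le_trans (show U'.1 ≤ U.1 from leOfHom i) h) := by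
  refine (Spec.map_comp _ _).symm.trans (congrArg Spec.map (CommRingCat.hom_ext ?_))
  refine (PointedAlgebra.map_comp k _ _).symm.trans (congrArg (PointedAlgebra.map k) ?_)
  change f.c.app (op V.1) ≫ X.presheaf.map _ ≫ X.presheaf.map _ = _
  rw [← X.presheaf.map_comp]
  rfl

theorem mapAffine_comp_realizationDiagram_map (f : X ⟶ Y) {U : X.AffineOpens}
    {V V' : Y.AffineOpens} (j : V ⟶ V') (h : U.1 ≤ (Opens.map f.base).obj V.1) :
    realizationMapAffine k f U V h ≫ (realizationDiagram k Y).map j =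
      realizationMapAffine k f U V' (h.trans ((Opens.map f.base).monotone (leOfHom j))) := by
  refine (Spec.map_comp _ _).symm.trans (congrArg Spec.map (CommRingCat.hom_ext ?_))
  refine (PointedAlgebra.map_comp k _ _).symm.trans (congrArg (PointedAlgebra.map k) ?_)
  change Y.presheaf.map _ ≫ f.c.app (op V.1) ≫ X.presheaf.map _ = _
  rw [← Category.assoc, f.c.naturality, Category.assoc]
  change _ ≫ X.presheaf.map _ ≫ X.presheaf.map _ = _
  rw [← X.presheaf.map_comp]
  rfl

/-- The composite `U_k → V_k → Y_k` does not depend on the choice of `V`. -/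
theorem mapAffine_comp_ι_eq [Y.IsMonoidScheme] (f : X ⟶ Y) (U : X.AffineOpens)
    (V V' : Y.AffineOpens) (h : U.1 ≤ (Opens.map f.base).obj V.1)
    (h' : U.1 ≤ (Opens.map f.base).obj V'.1) :
    realizationMapAffine k f U V h ≫ realizationι k Y V =
      realizationMapAffine k f U V' h' ≫ realizationι k Y V' := by
  obtain ⟨x, hx, hroot⟩ := U.2.1.exists_root U.2.2
  obtain ⟨W, hxW, hW, hWV⟩ := exists_isAffineOpen_le (f.base x) (V.1 ⊓ V'.1) ⟨h hx, h' hx⟩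
  let W' : Y.AffineOpens := ⟨W, hW, f.base x, hxW⟩
  have hUW : U.1 ≤ (Opens.map f.base).obj W'.1 := hroot ((Opens.map f.base).obj W) hxW
  let j : W' ⟶ V := homOfLE (hWV.trans inf_le_left)
  let j' : W' ⟶ V' := homOfLE (hWV.trans inf_le_right)
  rw [← mapAffine_comp_realizationDiagram_map f j hUW,
    ← mapAffine_comp_realizationDiagram_map f j' hUW, Category.assoc, Category.assoc,
    realizationDiagram_map_comp_ι, realizationDiagram_map_comp_ι]

/-- The `k`-realization `f_k : X_k → Y_k` of a morphism `f : X → Y` of monoid schemes: its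
restriction to `U_k`, for an affine open `U ⊆ X`, is the composite `U_k → V_k → Y_k` for any affine
open `V ⊆ Y` with `f(U) ⊆ V`. -/
def realizationMap (k : Type u) [CommRing k] [Y.IsMonoidScheme] (f : X ⟶ Y) :
    realization k X ⟶ realization k Y :=
  Limits.colimit.desc (realizationDiagram k X)
    { pt := realization k Y
      ι :=
        { app := fun U => realizationMapAffine k f U (exists_le_comap f U).choose
            (exists_le_comap f U).choose_spec ≫ realizationι k Y (exists_le_comap f U).choose
          naturality := fun U U' i => by
            rw [← Category.assoc, realizationDiagram_map_comp_mapAffine]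
            exact (mapAffine_comp_ι_eq f U _ _ _ _).trans (Category.comp_id _).symm } }

theorem ι_comp_realizationMap [Y.IsMonoidScheme] (f : X ⟶ Y) (U : X.AffineOpens)
    (V : Y.AffineOpens) (h : U.1 ≤ (Opens.map f.base).obj V.1) :
    realizationι k X U ≫ realizationMap k f =
      realizationMapAffine k f U V h ≫ realizationι k Y V :=
  (Limits.colimit.ι_desc _ U).trans (mapAffine_comp_ι_eq f U _ _ _ _)

end MonoidSpace

/-- The pointed group completion `V⁺` of a cancellative pointed monoid `V`: the localization of `V`
at its non-zero elements. -/
abbrev GroupCompletion (V : Type u) [CommMonoidWithZero V] : Type u :=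
  Localization (nonZeroDivisors V)

/-- The inclusion `V → V⁺`. -/
def toGroupCompletion (V : Type u) [CommMonoidWithZero V] : V →*₀ GroupCompletion V where
  toFun v := Localization.mk v 1
  map_zero' := Localization.mk_zero _
  map_one' := Localization.mk_one
  map_mul' a b := by rw [Localization.mk_mul, one_mul]

/-- A valuation monoid: a (non-zero) cancellative pointed monoid `V` such that for every non-zero
`α ∈ V⁺` at least one of `α` and `1/α` belongs to `V`. -/
class ValuationMonoid (V : Type u) [CommMonoidWithZero V] : Prop
    extends IsCancelMulZero V, Nontrivial V where
  mem_or_inv_mem : ∀ α : GroupCompletion V, α ≠ 0 →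
    (∃ v, toGroupCompletion V v = α) ∨ ∃ v, α * toGroupCompletion V v = 1

/-- A morphism of monoid spaces satisfies the valuative criterion of properness if for every
valuation monoid `V` and every commutative square
```
MSpec V⁺ ⟶ X
   |        |
   ↓        ↓
MSpec V  ⟶ Y
```
there is a unique morphism `MSpec V ⟶ X` making both triangles commute. -/
def MonoidSpace.ValuativeCriterionProper {X Y : MonoidSpace.{u}} (f : X ⟶ Y) : Prop :=
  ∀ (V : Type u) [CommMonoidWithZero V] [ValuationMonoid V]
    (i₁ : MSpec (GroupCompletion V) ⟶ X) (i₂ : MSpec V ⟶ Y),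
    i₁ ≫ f = MSpec.map (toGroupCompletion V) ≫ i₂ →
    ∃! l : MSpec V ⟶ X, MSpec.map (toGroupCompletion V) ≫ l = i₁ ∧ l ≫ f = i₂

/-- A morphism of monoid spaces satisfies the valuative criterion of separatedness if every square
as in `MonoidSpace.ValuativeCriterionProper` has at most one completion. -/
def MonoidSpace.ValuativeCriterionSeparated {X Y : MonoidSpace.{u}} (f : X ⟶ Y) : Prop :=
  ∀ (V : Type u) [CommMonoidWithZero V] [ValuationMonoid V]
    (i₁ : MSpec (GroupCompletion V) ⟶ X) (i₂ : MSpec V ⟶ Y),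
    i₁ ≫ f = MSpec.map (toGroupCompletion V) ≫ i₂ →
    ∀ l l' : MSpec V ⟶ X, MSpec.map (toGroupCompletion V) ≫ l = i₁ ∧ l ≫ f = i₂ →
      MSpec.map (toGroupCompletion V) ≫ l' = i₁ ∧ l' ≫ f = i₂ → l = l'

end

/-!
The proof rests on a comparison of points. A local ring `R` is regarded as a pointed monoid under
multiplication. A morphism from `Spec R` to `X_k` factors through `Spec k[𝒜(W)]` for some affine
open `W ⊆ X`, so it is given by a ring map `ρ : k → R` and a map of pointed monoids `𝒜(W) → R`, and
two such descriptions of one morphism agree over a smaller affine open. A morphism `MSpec R ⟶ X`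
is given by maps `𝒜(W) → R` in the same way (`MonoidSpace.IsChart`), because the closed point of
`MSpec R` has no neighbourhood but the whole space. Hence `X_k(R)` is the product of `Hom(k, R)` and
of the set of morphisms `MSpec R ⟶ X`, naturally in `R` and `X`. This bijection is the relation
`MonoidSpace.Realizes`, and `MonoidSpace.isLift_iff_of_realizes` says that it matches the lifts in a
square over `f_k` with those in the corresponding square over `f`.

If `R` is a valuation ring with field of fractions `K`, then its multiplicative monoid is a
valuation monoid with group completion `K`. So the criteria for `f` imply those for `f_k`.

Conversely, let `V` be a valuation monoid with value group `Γ`, the group of units of `V⁺` modulo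
the units of `V`. Let `F` be the field of Hahn series over `k` with exponents in `Γ` and `R` its
valuation ring of series of non-negative order. Mapping an element of `V⁺` to the monomial of its
value gives `θ : V⁺ → F` with `θ⁻¹(R) = V` (`ValuationMonoid.exists_valuationRing`). The map `θ` need
not be injective, and it could not always be: `V⁺` may have more torsion than a field allows.
Nevertheless the morphisms out of `MSpec V` are the compatible pairs of morphisms out of
`MSpec V⁺` and `MSpec R` (`MonoidSpace.eq_of_map_comp_eq`, `MonoidSpace.exists_map_comp_eq`): the
closed point of `MSpec R` maps to that of `MSpec V`, which provides an affine open `W` through which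
everything factors, and a map `𝒜(W) → V⁺` whose composite with `θ` takes values in `R` takes values
in `V`. With this, lifts in a square over `f` are obtained from, and distinguished by, lifts in the
induced square over `f_k`.
-/

/-! ### Morphisms out of the spectrum of a pointed monoid -/

namespace MPrime

variable {M : Type u} [CommMonoidWithZero M]

variable (M) in
/-- The closed point of the spectrum of a non-zero pointed monoid: the prime ideal of all
non-units. -/
def closedPoint [Nontrivial M] : MPrime M where
  carrier := {a | ¬ IsUnit a}
  zero_mem := not_isUnit_zero
  mul_mem _ _ hb h := hb (isUnit_of_mul_isUnit_right h)
  one_notMem h := h isUnit_one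
  mem_or_mem a b h := by
    by_contra! hab
    exact h ((not_not.1 hab.1).mul (not_not.1 hab.2))

theorem mem_compl_closedPoint [Nontrivial M] {a : M} : a ∈ (closedPoint M).compl ↔ IsUnit a :=
  not_not

/-- The only open neighbourhood of the closed point is the whole spectrum. -/
theorem mem_of_closedPoint_mem [Nontrivial M] {U : Opens (MPrime M)} (h : closedPoint M ∈ U)
    (p : MPrime M) : p ∈ U := by
  obtain ⟨s, hs, hU⟩ := U.isOpen _ h
  exact hU p fun hp => p.one_notMem <| by
    obtain ⟨t, ht⟩ := (mem_compl_closedPoint.1 hs).exists_left_inv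
    exact ht ▸ p.mul_mem _ _ hp

theorem mk_one_closedPoint_injective [Nontrivial M] :
    Function.Injective fun a : M => (Localization.mk a 1 : Localization (closedPoint M).compl) := by
  intro a b h
  obtain ⟨c, h⟩ := Localization.r_iff_exists.1 (Localization.mk_eq_mk_iff.1 h)
  exact (mem_compl_closedPoint.1 c.2).mul_left_cancel (by simpa using h)

theorem comap_closedPoint {N : Type u} [CommMonoidWithZero N] [Nontrivial M] [Nontrivial N]
    (φ : M →*₀ N) (hφ : ∀ a, IsUnit (φ a) → IsUnit a) :
    comap φ (closedPoint N) = closedPoint M := by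
  ext a
  exact not_congr ⟨hφ a, fun h => h.map φ⟩

/-- In a pointed monoid all of whose non-zero elements are units, the closed point is the only
prime ideal. -/
theorem eq_closedPoint_of_forall_isUnit [Nontrivial M] (h : ∀ a : M, a ≠ 0 → IsUnit a)
    (p : MPrime M) : p = closedPoint M := by
  ext a
  constructor
  · intro ha hu
    obtain ⟨t, ht⟩ := hu.exists_left_inv
    exact p.one_notMem (ht ▸ p.mul_mem _ _ ha)
  · intro ha
    obtain rfl : a = 0 := by_contra fun h0 => ha (h a h0)
    exact p.zero_mem

end MPrime

namespace MonoidSpace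

variable {M N : Type u} [CommMonoidWithZero M] [CommMonoidWithZero N] {X Y : MonoidSpace.{u}}

/-- The composite `𝒜(U) → Γ(h⁻¹ U) → M_p` for a morphism `h : MSpec M ⟶ X` and a prime ideal `p`
with `h p ∈ U`. -/
def germPull (h : MSpec M ⟶ X) (U : Opens X) (p : MPrime M) (hp : h.base p ∈ U) :
    X.presheaf.obj (op U) →*₀ Localization p.compl where
  toFun s := MPrime.Sections.val (U := (Opens.map h.base).obj U) (h.c.app (op U) s) ⟨p, hp⟩
  map_zero' := congrArg (fun z => MPrime.Sections.val (U := (Opens.map h.base).obj U) z ⟨p, hp⟩)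
    (map_zero (ConcreteCategory.hom (h.c.app (op U))))
  map_one' := congrArg (fun z => MPrime.Sections.val (U := (Opens.map h.base).obj U) z ⟨p, hp⟩)
    (map_one (ConcreteCategory.hom (h.c.app (op U))))
  map_mul' a b := congrArg (fun z => MPrime.Sections.val (U := (Opens.map h.base).obj U) z ⟨p, hp⟩)
    (map_mul (ConcreteCategory.hom (h.c.app (op U))) a b)

theorem germPull_res (h : MSpec M ⟶ X) {U V : Opens X} (i : V ⟶ U) (p : MPrime M)
    (hp : h.base p ∈ V) (s : X.presheaf.obj (op U)) :
    germPull h V p hp (X.presheaf.map i.op s) = germPull h U p (leOfHom i hp) s := by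
  have e := congrArg (fun g : X.presheaf.obj (op U) ⟶ _ => g s) (h.c.naturality i.op)
  exact congrArg (fun z => MPrime.Sections.val (U := (Opens.map h.base).obj V) z ⟨p, hp⟩) e

theorem germPull_comp (h : MSpec M ⟶ X) (f : X ⟶ Y) (V : Opens Y) (p : MPrime M)
    (hp : f.base (h.base p) ∈ V) (s : Y.presheaf.obj (op V)) :
    germPull (h ≫ f) V p hp s =
      germPull h ((Opens.map f.base).obj V) p hp (f.c.app (op V) s) := rfl

theorem isUnitAt_iff_isUnit_germPull (h : MSpec M ⟶ X) {U : Opens X} (p : MPrime M)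
    (hp : h.base p ∈ U) (s : X.presheaf.obj (op U)) :
    IsUnitAt X.presheaf s (h.base p) ↔ IsUnit (germPull h U p hp s) := by
  refine Iff.trans ?_ (MSpec.isUnitAt_iff (U := (Opens.map h.base).obj U) (h.c.app (op U) s) p hp)
  exact ⟨isUnitAt_map h.toHom.toPshHom p s, h.isLocal p U s hp⟩

/-- A morphism out of the spectrum of a pointed monoid is determined by the underlying map and the
pullbacks of germs. -/
theorem MSpec_hom_ext {h h' : MSpec M ⟶ X} (hb : ∀ p : MPrime M, h.base p = h'.base p)
    (hc : ∀ (U : Opens X) (s : X.presheaf.obj (op U)) (p : MPrime M) (hp : h.base p ∈ U)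
      (hp' : h'.base p ∈ U), germPull h U p hp s = germPull h' U p hp' s) : h = h' := by
  obtain ⟨⟨b, c⟩, l⟩ := h
  obtain ⟨⟨b', c'⟩, l'⟩ := h'
  obtain rfl : b = b' := by
    ext p
    exact hb p
  obtain rfl : c = c' := by
    refine NatTrans.ext (funext fun U => ?_)
    refine DFunLike.ext (F := X.presheaf.obj U →*₀ _) _ _ fun s => MPrime.Sections.ext' fun p => ?_
    exact hc U.unop s p.1 p.2 p.2
  rfl

/-- The restriction of sections, as a map of pointed monoids. -/
def resHom {U V : Opens X} (i : V ⟶ U) : X.presheaf.obj (op U) →*₀ X.presheaf.obj (op V) :=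
  ConcreteCategory.hom (X.presheaf.map i.op)

/-- The map `𝒜(V) → 𝒜(U)` induced by a morphism `f` with `f(U) ⊆ V`. -/
def appLE (f : X ⟶ Y) (V : Opens Y) (U : Opens X) (h : U ≤ (Opens.map f.base).obj V) :
    Y.presheaf.obj (op V) →*₀ X.presheaf.obj (op U) :=
  ConcreteCategory.hom (f.c.app (op V) ≫ X.presheaf.map (homOfLE h).op)

/-- A chart of a morphism `h : MSpec M ⟶ X`: an open subset `W` of `X` containing the image of `h`
together with the map `φ : 𝒜(W) → Γ(MSpec M) = M` induced by `h`. -/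
structure IsChart (h : MSpec M ⟶ X) (W : Opens X) (φ : X.presheaf.obj (op W) →*₀ M) : Prop where
  mem : ∀ p : MPrime M, h.base p ∈ W
  germPull_eq : ∀ (p : MPrime M) (hp : h.base p ∈ W) (a : X.presheaf.obj (op W)),
    germPull h W p hp a = Localization.mk (φ a) 1

theorem exists_isChart [Nontrivial M] (h : MSpec M ⟶ X) {W : Opens X}
    (hW : h.base (MPrime.closedPoint M) ∈ W) : ∃ φ, IsChart h W φ := by
  have mem : ∀ p : MPrime M, h.base p ∈ W :=
    MPrime.mem_of_closedPoint_mem (U := (Opens.map h.base).obj W) hW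
  let W' : Opens (MPrime M) := (Opens.map h.base).obj W
  let t := MPrime.toSections W'
  have ht : Function.Bijective t := MPrime.toSections_bijective _
    (top_unique fun p _ => mem p) (MPrime.closedPoint M)
  let c : X.presheaf.obj (op W) →*₀ MPrime.Sections W' :=
    ConcreteCategory.hom (h.c.app (op W))
  let e := MulEquiv.ofBijective t ht
  have he : ∀ x, t (e.symm x) = x := e.apply_symm_apply
  let φ : X.presheaf.obj (op W) →*₀ M :=
    { toFun := fun a => e.symm (c a)
      map_zero' := ht.1 (by rw [he, map_zero, map_zero])
      map_one' := ht.1 (by rw [he, map_one, map_one])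
      map_mul' := fun a b => ht.1 (by rw [he, map_mul, map_mul, he, he]) }
  refine ⟨φ, mem, fun p hp a => ?_⟩
  exact congrArg (fun z : MPrime.Sections W' => z.val ⟨p, hp⟩)
    (he (c a)).symm

namespace IsChart

variable {h h' : MSpec M ⟶ X} {W : Opens X} {φ φ' : X.presheaf.obj (op W) →*₀ M}

theorem unique [Nontrivial M] (H : IsChart h W φ) (H' : IsChart h W φ') : φ = φ' := by
  ext a
  refine MPrime.mk_one_closedPoint_injective ?_
  exact (H.germPull_eq _ (H.mem _) a).symm.trans (H'.germPull_eq _ (H.mem _) a)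

theorem res (H : IsChart h W φ) {V : Opens X} (i : W ⟶ V) :
    IsChart h V (φ.comp (resHom i)) where
  mem p := leOfHom i (H.mem p)
  germPull_eq p _ a := (germPull_res h i p (H.mem p) a).symm.trans (H.germPull_eq p (H.mem p) _)

theorem map_comp (H : IsChart h W φ) (ψ : M →*₀ N) :
    IsChart (MSpec.map ψ ≫ h) W (ψ.comp φ) where
  mem q := H.mem (MPrime.comap ψ q)
  germPull_eq q hq a := by
    -- The germ pulled back along `MSpec.map ψ ≫ h` is by definition the image of the one pulled
    -- back along `h` under the map of localizations.
    refine (congrArg (MPrime.locMap ψ q) (H.germPull_eq _ _ a)).trans ?_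
    rw [MPrime.locMap_mk]
    congr 1
    exact Subtype.ext (map_one ψ)

theorem comp (H : IsChart h W φ) (f : X ⟶ Y) {V : Opens Y}
    (hV : W ≤ (Opens.map f.base).obj V) :
    IsChart (h ≫ f) V (φ.comp (appLE f V W hV)) where
  mem p := hV (H.mem p)
  germPull_eq p hp a := by
    rw [germPull_comp h f V p hp]
    exact (germPull_res h (homOfLE hV) p (H.mem p) _).symm.trans (H.germPull_eq p (H.mem p) _)

end IsChart

/-! ### Coordinates on an affine open subset -/

/-- An open immersion of presheafed spaces between monoid spaces is a morphism of monoid spaces. -/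
def homOfIsOpenImmersion (g : X.toPresheafedSpace ⟶ Y.toPresheafedSpace)
    [hg : PresheafedSpace.IsOpenImmersion g] : X ⟶ Y where
  toHom := g
  isLocal x V s hx := by
    rintro ⟨W', i, hxW', hu⟩
    let W : Opens Y := ⟨g.base '' W', hg.base_open.isOpenMap _ W'.isOpen⟩
    have hWW' : (Opens.map g.base).obj W ≤ W' := by
      rintro y ⟨y', hy', e⟩
      rwa [← hg.base_open.injective e]
    have hWV : W ≤ V := by
      rintro _ ⟨y, hy, rfl⟩
      exact leOfHom i hy
    have hiso : IsIso (g.c.app (op W)) := by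
      refine PresheafedSpace.IsOpenImmersion.c_iso' g ((Opens.map g.base).obj W) ?_
      ext y
      constructor
      · rintro ⟨y, hy, rfl⟩
        exact ⟨y, ⟨y, hy, rfl⟩, rfl⟩
      · rintro ⟨y, hy, rfl⟩
        exact hy
    refine ⟨W, homOfLE hWV, ⟨x, hxW', rfl⟩, ?_⟩
    have e := congrArg (fun l : Y.presheaf.obj (op V) ⟶ _ => l s) (g.c.naturality (homOfLE hWV).op)
    change g.c.app (op W) (Y.presheaf.map (homOfLE hWV).op s) =
      X.presheaf.map ((Opens.map g.base).map (homOfLE hWV)).op (g.c.app (op V) s) at e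
    have e' : X.presheaf.map ((Opens.map g.base).map (homOfLE hWV)).op (g.c.app (op V) s) =
        X.presheaf.map (homOfLE hWW').op (X.presheaf.map i.op (g.c.app (op V) s)) := by
      refine congrArg (fun l : X.presheaf.obj _ ⟶ X.presheaf.obj (op ((Opens.map g.base).obj W)) =>
        l (g.c.app (op V) s)) (?_ : _ = X.presheaf.map i.op ≫ X.presheaf.map (homOfLE hWW').op)
      rw [← X.presheaf.map_comp]
      rfl
    have hu' : IsUnit (g.c.app (op W) (Y.presheaf.map (homOfLE hWV).op s)) := by
      rw [e, e']
      exact hu.map (ConcreteCategory.hom (X.presheaf.map (homOfLE hWW').op))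
    have := hu'.map (ConcreteCategory.hom (inv (g.c.app (op W))))
    rwa [show ConcreteCategory.hom (inv (g.c.app (op W))) (g.c.app (op W)
      (Y.presheaf.map (homOfLE hWV).op s)) = _ from congrArg (fun l : Y.presheaf.obj (op W) ⟶ _ =>
      l (Y.presheaf.map (homOfLE hWV).op s)) (IsIso.hom_inv_id (g.c.app (op W)))] at this

/-- Coordinates on a non-empty affine open subset `W`: an open immersion `g : MSpec B ⟶ X` with
image `W`, the induced isomorphism `γ : B → 𝒜(W)`, and the description of the sections over
small neighbourhoods of a point as localizations of `𝒜(W)`. -/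
theorem IsAffineOpen.exists_immersion {W : Opens X} (hW : X.IsAffineOpen W)
    (hne : (W : Set X).Nonempty) :
    ∃ (B : PtdMon.{u}) (g : MSpec B ⟶ X) (γ : B →*₀ X.presheaf.obj (op W)),
      Function.Bijective γ ∧ Set.range g.base = W ∧
      (∀ (q : MPrime B) (hq : g.base q ∈ W) (b : B),
        germPull g W q hq (γ b) = Localization.mk b 1) ∧
      ∀ (q : MPrime B) (U : Opens X), g.base q ∈ U → ∃ (D : Opens X) (i : D ⟶ W) (s : B),
        g.base q ∈ D ∧ D ≤ U ∧
        (Submonoid.powers (γ s)).IsLocalizationMap (resHom i) := by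
  obtain ⟨B, g, hg, hr⟩ := isAffineOpen_iff.1 hW
  have key : ∀ U : Opens X, U ≤ W → IsIso (g.c.app (op U)) := by
    intro U hU
    refine PresheafedSpace.IsOpenImmersion.c_iso' g ((Opens.map g.base).obj U) ?_
    ext x
    constructor
    · intro hx
      obtain ⟨q, rfl⟩ : x ∈ Set.range g.base := by rw [hr]; exact hU hx
      exact ⟨q, hx, rfl⟩
    · rintro ⟨q, hq, rfl⟩
      exact hq
  have hiso := key W le_rfl
  have hmem : ∀ q : MPrime B, g.base q ∈ W := fun q => hr.le ⟨q, rfl⟩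
  have htop : (Opens.map g.base).obj W = ⊤ := top_unique fun q _ => hmem q
  obtain ⟨x, hx⟩ := hne
  obtain ⟨p, rfl⟩ : x ∈ Set.range g.base := by rw [hr]; exact hx
  let γ : B →*₀ X.presheaf.obj (op W) :=
    (ConcreteCategory.hom (inv (g.c.app (op W)))).comp
      (MPrime.toSections ((Opens.map g.base).obj W))
  have hγ : ∀ b, g.c.app (op W) (γ b) = MPrime.toSections ((Opens.map g.base).obj W) b := fun b =>
    congrArg (fun f : (MSpec B).presheaf.obj (op ((Opens.map g.base).obj W)) ⟶ _ =>
      f (MPrime.toSections ((Opens.map g.base).obj W) b)) (IsIso.inv_hom_id (g.c.app (op W)))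
  have hγb : Function.Bijective γ :=
    (PtdMon.bijective_of_isIso (inv (g.c.app (op W)))).comp
      (MPrime.toSections_bijective _ htop p)
  refine ⟨B, homOfIsOpenImmersion g, γ, hγb, hr, fun q hq b => ?_,
    fun q U hq => ?_⟩
  · exact congrArg (fun z : MPrime.Sections ((Opens.map g.base).obj W) => z.val ⟨q, hq⟩) (hγ b)
  · obtain ⟨s, hs, hsU⟩ := ((Opens.map g.base).obj U).isOpen q hq
    let D : Opens X :=
      ⟨g.base '' MSpec.basicOpen s, hg.base_open.isOpenMap _ (MSpec.basicOpen s).isOpen⟩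
    have hDW : D ≤ W := by
      rintro _ ⟨r, -, rfl⟩
      exact hmem r
    refine ⟨D, homOfLE hDW, s, ⟨q, hs, rfl⟩, ?_, ?_⟩
    · rintro _ ⟨r, hr, rfl⟩
      exact hsU r hr
    have hiD := key D hDW
    have hD : (Opens.map g.base).obj D = MPrime.basicOpen s := by
      ext r
      exact hg.base_open.injective.mem_set_image
    let f₂ : X.presheaf.obj (op D) →*₀ (MSpec B).presheaf.obj (op ((Opens.map g.base).obj D)) :=
      ConcreteCategory.hom (g.c.app (op D))
    refine isLocalizationMap_of_bijective γ hγb (resHom (homOfLE hDW)) f₂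
      (PtdMon.bijective_of_isIso (g.c.app (op D)))
      (MPrime.toSections ((Opens.map g.base).obj D)) (fun b => ?_) s ?_
    · have h := congrArg (fun f : X.presheaf.obj (op W) ⟶ _ => f (γ b))
        (g.c.naturality (homOfLE hDW).op)
      refine h.trans ?_
      exact congrArg ((MSpec B).presheaf.map ((Opens.map g.base).map (homOfLE hDW)).op) (hγ b)
    · have := MPrime.isLocalizationMap_toSections s q hs
      rwa [← hD] at this

/-- A morphism whose image lies in an affine open subset is determined by the induced map on
sections. -/
theorem IsChart.hom_ext {h h' : MSpec M ⟶ X} {W : Opens X} (hW : X.IsAffineOpen W)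
    {φ : X.presheaf.obj (op W) →*₀ M} (H : IsChart h W φ) (H' : IsChart h' W φ) : h = h' := by
  rcases isEmpty_or_nonempty (MPrime M) with hM | ⟨⟨p₀⟩⟩
  · exact MSpec_hom_ext (fun p => hM.elim p) (fun _ _ p => hM.elim p)
  obtain ⟨B, g, γ, -, hr, hval, hloc⟩ := hW.exists_immersion ⟨_, H.mem p₀⟩
  -- The point `g q` of `W` is determined by the prime ideal `q`, hence by which sections over `W`
  -- are invertible at it.
  have key : ∀ {l : MSpec M ⟶ X} (_ : IsChart l W φ) (p : MPrime M) (q : MPrime B),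
      g.base q = l.base p → ∀ b, b ∈ q.compl ↔
        IsUnit (Localization.mk (φ (γ b)) 1 : Localization p.compl) := by
    intro l L p q e b
    have hq : g.base q ∈ W := e ▸ L.mem p
    rw [← MSpec.isUnit_mk_iff q b 1, ← hval q hq, ← isUnitAt_iff_isUnit_germPull, e,
      isUnitAt_iff_isUnit_germPull l p (L.mem p), L.germPull_eq]
  have hb : ∀ p : MPrime M, h.base p = h'.base p := by
    intro p
    obtain ⟨q, hq⟩ : h.base p ∈ Set.range g.base := hr.ge (H.mem p)
    obtain ⟨q', hq'⟩ : h'.base p ∈ Set.range g.base := hr.ge (H'.mem p)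
    have : q = q' := by
      refine MPrime.ext (Set.ext fun b => ?_)
      exact not_iff_not.1 ((key H p q hq b).trans (key H' p q' hq' b).symm)
    rw [← hq, ← hq', this]
  refine MSpec_hom_ext hb fun U s p hp hp' => ?_
  obtain ⟨q, hq⟩ : h.base p ∈ Set.range g.base := hr.ge (H.mem p)
  -- Near `h p` the section `s` is a fraction of sections over `W`, on which both pullbacks agree.
  obtain ⟨D, i, s₀, hqD, hDU, hD⟩ := hloc q U (hq ▸ hp)
  have hpD : h.base p ∈ D := hq ▸ hqD
  have hpD' : h'.base p ∈ D := hb p ▸ hpD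
  rw [← germPull_res h (homOfLE hDU) p hpD, ← germPull_res h' (homOfLE hDU) p hpD']
  obtain ⟨⟨a, t⟩, e⟩ := hD.surj (X.presheaf.map (homOfLE hDU).op s)
  have hu := (hD.map_units t).map (germPull h D p hpD)
  have e₁ := congrArg (germPull h D p hpD) e
  have e₂ := congrArg (germPull h' D p hpD') e
  refine hu.mul_right_cancel ?_
  rw [map_mul] at e₁ e₂
  have key' : ∀ b, germPull h D p hpD (resHom i b) = germPull h' D p hpD' (resHom i b) := fun b =>
    (germPull_res h i p hpD b).trans <| (H.germPull_eq p _ b).trans <|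
      (H'.germPull_eq p _ b).symm.trans (germPull_res h' i p hpD' b).symm
  exact e₁.trans ((key' a).trans (e₂.symm.trans (congrArg _ (key' t).symm)))

/-- Every map `𝒜(W) → M`, for an affine open subset `W`, comes from a morphism `MSpec M ⟶ X`. -/
theorem IsAffineOpen.exists_hom {W : Opens X} (hW : X.IsAffineOpen W)
    (hne : (W : Set X).Nonempty) (φ : X.presheaf.obj (op W) →*₀ M) : ∃ h, IsChart h W φ := by
  obtain ⟨B, g, γ, hγ, hr, hval, -⟩ := hW.exists_immersion hne
  refine ⟨MSpec.map (φ.comp γ) ≫ g, fun p => hr.le ⟨_, rfl⟩, fun p hp a => ?_⟩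
  obtain ⟨b, rfl⟩ := hγ.2 a
  refine (congrArg (MPrime.locMap (φ.comp γ) p) (hval _ hp b)).trans
    ((MPrime.locMap_mk (φ.comp γ) p b 1).trans ?_)
  exact congrArg (Localization.mk _) (Subtype.ext (map_one (φ.comp γ)))

end MonoidSpace

/-! ### Points of the realization in local rings -/

namespace PointedAlgebra

variable {k : Type u} [CommRing k] {A B : Type u} [CommMonoidWithZero A] [CommMonoidWithZero B]
  {R S : Type u} [CommRing R] [CommRing S]

theorem lift_eta (g : PointedAlgebra k A →+* R) :
    lift (g.comp (coeff k)) (g.toMonoidWithZeroHom.comp (of k)) = g :=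
  hom_ext (fun _ => lift_coeff ..) (fun _ => lift_of ..)

theorem lift_comp_map (ρ : k →+* R) (φ : A →*₀ R) (ψ : B →*₀ A) :
    (lift ρ φ).comp (map k ψ) = lift ρ (φ.comp ψ) :=
  hom_ext (fun _ => by simp [map_coeff, lift_coeff]) (fun _ => by simp [map_of, lift_of])

theorem comp_lift (ρ : k →+* R) (φ : A →*₀ R) (χ : R →+* S) :
    χ.comp (lift ρ φ) = lift (χ.comp ρ) (χ.toMonoidWithZeroHom.comp φ) :=
  hom_ext (fun _ => by simp [lift_coeff]) (fun _ => by simp [lift_of])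

theorem lift_injective {ρ ρ' : k →+* R} {φ φ' : A →*₀ R} (h : lift ρ φ = lift ρ' φ') :
    ρ = ρ' ∧ φ = φ' := by
  constructor
  · ext c
    rw [← lift_coeff k ρ φ, h, lift_coeff]
  · ext a
    rw [← lift_of k ρ φ, h, lift_of]

end PointedAlgebra

namespace MonoidSpace

variable {k : Type u} [CommRing k] {X Y : MonoidSpace.{u}} {R S : Type u} [CommRing R] [CommRing S]

variable (k) in
/-- The open immersion `Spec k[𝒜(W)] → X_k`. -/
noncomputable def affineι (W : X.AffineOpens) :
    Spec (CommRingCat.of (PointedAlgebra k (X.presheaf.obj (op W.1)))) ⟶ realization k X :=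
  realizationι k X W

instance (W : X.AffineOpens) : IsOpenImmersion (affineι k W) :=
  inferInstanceAs (IsOpenImmersion (Limits.colimit.ι (realizationDiagram k X) W))

/-- The `R`-valued point of `X_k` factoring through `W_k = Spec k[𝒜(W)]` given by `ρ : k → R` and
`φ : 𝒜(W) → R`. -/
noncomputable def realizationPoint (W : X.AffineOpens) (ρ : k →+* R)
    (φ : X.presheaf.obj (op W.1) →*₀ R) : Spec (CommRingCat.of R) ⟶ realization k X :=
  Spec.map (CommRingCat.ofHom (PointedAlgebra.lift ρ φ)) ≫ affineι k W

theorem realizationPoint_res {W W' : X.AffineOpens} (i : W.1 ⟶ W'.1) (ρ : k →+* R)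
    (φ : X.presheaf.obj (op W.1) →*₀ R) :
    realizationPoint W' ρ (φ.comp (resHom i)) =
      realizationPoint W ρ φ := by
  let j : W ⟶ W' := homOfLE (leOfHom i)
  have h : Spec.map (CommRingCat.ofHom (PointedAlgebra.map k (resHom i))) ≫ affineι k W' =
    affineι k W := realizationDiagram_map_comp_ι j
  rw [realizationPoint, realizationPoint, ← h, ← Category.assoc, ← Spec.map_comp,
    ← CommRingCat.ofHom_comp, PointedAlgebra.lift_comp_map]

theorem map_comp_realizationPoint (χ : R →+* S) (W : X.AffineOpens) (ρ : k →+* R)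
    (φ : X.presheaf.obj (op W.1) →*₀ R) :
    Spec.map (CommRingCat.ofHom χ) ≫ realizationPoint W ρ φ =
      realizationPoint W (χ.comp ρ) (χ.toMonoidWithZeroHom.comp φ) := by
  rw [realizationPoint, realizationPoint, ← Category.assoc, ← Spec.map_comp,
    ← CommRingCat.ofHom_comp, PointedAlgebra.comp_lift]

theorem realizationPoint_comp [Y.IsMonoidScheme] (f : X ⟶ Y) (W : X.AffineOpens)
    (V : Y.AffineOpens) (hV : W.1 ≤ (Opens.map f.base).obj V.1) (ρ : k →+* R)
    (φ : X.presheaf.obj (op W.1) →*₀ R) :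
    realizationPoint W ρ φ ≫ realizationMap k f = realizationPoint V ρ
      (φ.comp (appLE f V.1 W.1 hV)) := by
  have h : affineι k W ≫ realizationMap k f =
      Spec.map (CommRingCat.ofHom (PointedAlgebra.map k (appLE f V.1 W.1 hV))) ≫ affineι k V :=
    ι_comp_realizationMap f W V hV
  rw [realizationPoint, realizationPoint, Category.assoc, h, ← Category.assoc, ← Spec.map_comp,
    ← CommRingCat.ofHom_comp, PointedAlgebra.lift_comp_map]

theorem realizationPoint_injective {W : X.AffineOpens} {ρ ρ' : k →+* R}
    {φ φ' : X.presheaf.obj (op W.1) →*₀ R}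
    (h : realizationPoint W ρ φ = realizationPoint W ρ' φ') : ρ = ρ' ∧ φ = φ' := by
  have h₁ := (cancel_mono (affineι k W)).1 h
  exact PointedAlgebra.lift_injective (congrArg CommRingCat.Hom.hom (Spec.map_injective h₁))

/-- An `R`-valued point of `X_k`, for a local ring `R`, factors through `W_k` if its closed point
lies in `W_k`. -/
theorem exists_realizationPoint_of_mem_range [IsLocalRing R]
    (s : Spec (CommRingCat.of R) ⟶ realization k X) (W : X.AffineOpens)
    (h : s (IsLocalRing.closedPoint R) ∈ Set.range (affineι k W)) :
    ∃ ρ φ, s = realizationPoint W ρ φ := by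
  have hr : Set.range s ⊆ Set.range (affineι k W) := by
    rintro _ ⟨y, rfl⟩
    exact ((IsLocalRing.specializes_closedPoint y).map s.continuous).mem_open
      (affineι k W).isOpenEmbedding.isOpen_range h
  let l : Spec (CommRingCat.of R) ⟶
      Spec (CommRingCat.of (PointedAlgebra k (X.presheaf.obj (op W.1)))) :=
    IsOpenImmersion.lift (affineι k W) s hr
  have hl : l ≫ affineι k W = s := IsOpenImmersion.lift_fac _ _ hr
  refine ⟨_, _, Eq.symm (Eq.trans (congrArg (fun g => Spec.map (CommRingCat.ofHom g) ≫ _)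
    (PointedAlgebra.lift_eta (Spec.preimage l).hom)) ?_)⟩
  refine Eq.trans ?_ hl
  congr 1
  exact Spec.map_preimage l

theorem exists_realizationPoint [IsLocalRing R] (s : Spec (CommRingCat.of R) ⟶ realization k X) :
    ∃ W ρ φ, s = realizationPoint W ρ φ := by
  obtain ⟨W, y, hy⟩ := Scheme.IsLocallyDirected.ι_jointly_surjective (realizationDiagram k X)
    (s (IsLocalRing.closedPoint R))
  exact ⟨W, exists_realizationPoint_of_mem_range s W ⟨y, hy⟩⟩

/-- Two representations of the same point in a local ring agree on a smaller affine open subset. -/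
theorem exists_realizationPoint_of_eq [IsLocalRing R] {W W' : X.AffineOpens} {ρ ρ' : k →+* R}
    {φ : X.presheaf.obj (op W.1) →*₀ R} {φ' : X.presheaf.obj (op W'.1) →*₀ R}
    (h : realizationPoint W ρ φ = realizationPoint W' ρ' φ') :
    ρ = ρ' ∧ ∃ (W₀ : X.AffineOpens) (i : W₀.1 ⟶ W.1) (i' : W₀.1 ⟶ W'.1)
      (φ₀ : X.presheaf.obj (op W₀.1) →*₀ R),
      φ₀.comp (resHom i) = φ ∧
      φ₀.comp (resHom i') = φ' := by
  let y : (realizationDiagram k X).obj W :=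
    Spec.map (CommRingCat.ofHom (PointedAlgebra.lift ρ φ)) (IsLocalRing.closedPoint R)
  let y' : (realizationDiagram k X).obj W' :=
    Spec.map (CommRingCat.ofHom (PointedAlgebra.lift ρ' φ')) (IsLocalRing.closedPoint R)
  have hy : realizationPoint W ρ φ (IsLocalRing.closedPoint R) = affineι k W y := rfl
  have hy' : realizationPoint W' ρ' φ' (IsLocalRing.closedPoint R) = affineι k W' y' := rfl
  obtain ⟨W₀, j, j', z, hz, hz'⟩ := (Scheme.IsLocallyDirected.ι_eq_ι_iff (realizationDiagram k X)).1
    (hy.symm.trans ((congrArg (fun s : Spec (CommRingCat.of R) ⟶ realization k X =>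
      s (IsLocalRing.closedPoint R)) h).trans hy'))
  have hW₀ : realizationPoint W ρ φ (IsLocalRing.closedPoint R) ∈
      Set.range (affineι k W₀) := by
    refine ⟨z, ?_⟩
    rw [hy, ← hz]
    exact congrArg (fun g : (realizationDiagram k X).obj W₀ ⟶ _ => g z)
      (realizationDiagram_map_comp_ι j).symm
  obtain ⟨ρ₀, φ₀, h₀⟩ := exists_realizationPoint_of_mem_range _ W₀ hW₀
  let i : W₀.1 ⟶ W.1 := homOfLE (leOfHom j)
  let i' : W₀.1 ⟶ W'.1 := homOfLE (leOfHom j')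
  obtain ⟨rfl, h₁⟩ := realizationPoint_injective (h₀.trans (realizationPoint_res i ρ₀ φ₀).symm)
  obtain ⟨rfl, h₂⟩ := realizationPoint_injective
    (h.symm.trans (h₀.trans (realizationPoint_res i' _ φ₀).symm))
  exact ⟨rfl, W₀, i, i', φ₀, h₁.symm, h₂.symm⟩

/-- The relation between `R`-valued points `s` of `X_k` and pairs of a ring map `ρ : k → R` and a
morphism `h : MSpec R ⟶ X`, where `R` is regarded as a pointed monoid under multiplication: over an
affine open `W`, both are given by the same map `𝒜(W) → R`. For a local ring `R` this is the graph
of a bijection. -/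
def Realizes (s : Spec (CommRingCat.of R) ⟶ realization k X) (ρ : k →+* R) (h : MSpec R ⟶ X) :
    Prop :=
  ∃ (W : X.AffineOpens) (φ : X.presheaf.obj (op W.1) →*₀ R),
    s = realizationPoint W ρ φ ∧ IsChart h W.1 φ

theorem exists_realizes_left [IsLocalRing R] (s : Spec (CommRingCat.of R) ⟶ realization k X) :
    ∃ ρ h, Realizes s ρ h := by
  obtain ⟨W, ρ, φ, rfl⟩ := exists_realizationPoint s
  obtain ⟨h, H⟩ := W.2.1.exists_hom W.2.2 φ
  exact ⟨ρ, h, W, φ, rfl, H⟩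

theorem exists_realizes_right [Nontrivial R] [X.IsMonoidScheme] (ρ : k →+* R) (h : MSpec R ⟶ X) :
    ∃ s, Realizes s ρ h := by
  obtain ⟨W, hxW, hW⟩ := IsMonoidScheme.exists_isAffineOpen (h.base (MPrime.closedPoint R))
  obtain ⟨φ, H⟩ := exists_isChart h hxW
  exact ⟨_, ⟨W, hW, _, hxW⟩, φ, rfl, H⟩

namespace Realizes

variable {s s' : Spec (CommRingCat.of R) ⟶ realization k X} {ρ ρ' : k →+* R} {h h' : MSpec R ⟶ X}

theorem right_unique [IsLocalRing R] (H : Realizes s ρ h) (H' : Realizes s ρ' h') :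
    ρ = ρ' ∧ h = h' := by
  obtain ⟨W, φ, rfl, hφ⟩ := H
  obtain ⟨W', φ', e, hφ'⟩ := H'
  obtain ⟨hρ, W₀, i, i', φ₀, rfl, rfl⟩ := exists_realizationPoint_of_eq e
  obtain ⟨h₀, H₀⟩ := W₀.2.1.exists_hom W₀.2.2 φ₀
  exact ⟨hρ, (IsChart.hom_ext W.2.1 hφ (H₀.res i)).trans (IsChart.hom_ext W'.2.1 (H₀.res i') hφ')⟩

theorem left_unique [Nontrivial R] [X.IsMonoidScheme] (H : Realizes s ρ h)
    (H' : Realizes s' ρ h) : s = s' := by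
  obtain ⟨W, φ, rfl, hφ⟩ := H
  obtain ⟨W', φ', rfl, hφ'⟩ := H'
  obtain ⟨W₀, hx, hW₀, hle⟩ := exists_isAffineOpen_le (h.base (MPrime.closedPoint R))
    (W.1 ⊓ W'.1) ⟨hφ.mem _, hφ'.mem _⟩
  obtain ⟨φ₀, H₀⟩ := exists_isChart h hx
  let W₁ : X.AffineOpens := ⟨W₀, hW₀, _, hx⟩
  let i : W₁.1 ⟶ W.1 := homOfLE (hle.trans inf_le_left)
  let i' : W₁.1 ⟶ W'.1 := homOfLE (hle.trans inf_le_right)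
  rw [hφ.unique (H₀.res i), hφ'.unique (H₀.res i')]
  exact (realizationPoint_res i ρ φ₀).trans (realizationPoint_res i' ρ φ₀).symm

theorem map_comp (H : Realizes s ρ h) (χ : R →+* S) :
    Realizes (Spec.map (CommRingCat.ofHom χ) ≫ s) (χ.comp ρ)
      (MSpec.map χ.toMonoidWithZeroHom ≫ h) := by
  obtain ⟨W, φ, rfl, hφ⟩ := H
  exact ⟨W, _, map_comp_realizationPoint χ W ρ φ, hφ.map_comp _⟩

theorem comp [Y.IsMonoidScheme] (H : Realizes s ρ h) (f : X ⟶ Y) :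
    Realizes (s ≫ realizationMap k f) ρ (h ≫ f) := by
  obtain ⟨W, φ, rfl, hφ⟩ := H
  obtain ⟨V, hV⟩ := exists_le_comap f W
  exact ⟨V, _, realizationPoint_comp f W V hV ρ φ, hφ.comp f hV⟩

end Realizes

end MonoidSpace

/-! ### Group completions and valuation monoids -/

namespace GroupCompletion

variable {V : Type u} [CommMonoidWithZero V]

theorem isUnit_of_ne_zero [IsCancelMulZero V] [Nontrivial V] {g : GroupCompletion V} (hg : g ≠ 0) :
    IsUnit g := by
  induction g using Localization.induction_on with | H y => ?_
  have hy : y.1 ≠ 0 := fun h => hg (by rw [h, Localization.mk_zero])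
  refine isUnit_iff_exists_inv.2 ⟨Localization.mk y.2 ⟨y.1, mem_nonZeroDivisors_of_ne_zero hy⟩, ?_⟩
  rw [Localization.mk_mul, ← Localization.mk_one, Localization.mk_eq_mk_iff,
    Localization.r_iff_exists]
  exact ⟨1, by simp [mul_comm]⟩

instance [Nontrivial V] : Nontrivial (GroupCompletion V) := by
  refine ⟨⟨1, 0, fun h => ?_⟩⟩
  rw [← Localization.mk_one, ← Localization.mk_zero (1 : nonZeroDivisors V),
    Localization.mk_eq_mk_iff, Localization.r_iff_exists] at h
  obtain ⟨c, hc⟩ := h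
  refine nonZeroDivisors.ne_zero c.2 ?_
  simp at hc

end GroupCompletion

theorem toGroupCompletion_injective (V : Type u) [CommMonoidWithZero V] [IsCancelMulZero V]
    [Nontrivial V] :
    Function.Injective (toGroupCompletion V) := by
  intro a b h
  obtain ⟨c, hc⟩ := Localization.r_iff_exists.1 (Localization.mk_eq_mk_iff.1 h)
  have hc : (c : V) * a = c * b := by simpa using hc
  exact mul_left_cancel₀ (nonZeroDivisors.ne_zero c.2) hc

/-- The value group of a valuation monoid: the group of units of `V⁺` modulo the units of `V`,
ordered so that the classes of elements of `V` are those which are at least `1`. -/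
theorem ValuationMonoid.exists_valueGroup (V : Type u) [CommMonoidWithZero V] [ValuationMonoid V] :
    ∃ (Γ : Type u) (_ : CommGroup Γ) (_ : LinearOrder Γ) (_ : IsOrderedMonoid Γ)
      (v : (GroupCompletion V)ˣ →* Γ), ∀ g, 1 ≤ v g ↔ ∃ a, toGroupCompletion V a = g := by
  classical
  let P : Submonoid (GroupCompletion V)ˣ :=
    { carrier := {g | ∃ a, toGroupCompletion V a = g}
      one_mem' := ⟨1, map_one _⟩
      mul_mem' := by
        rintro g h ⟨a, ha⟩ ⟨b, hb⟩
        exact ⟨a * b, by rw [map_mul, ha, hb, Units.val_mul]⟩ }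
  have hP : ∀ g : (GroupCompletion V)ˣ, g ∈ P ∨ g⁻¹ ∈ P := by
    intro g
    refine (mem_or_inv_mem (g : GroupCompletion V) g.ne_zero).imp id ?_
    rintro ⟨a, ha⟩
    exact ⟨a, by rw [← Units.inv_mul_cancel_left g (toGroupCompletion V a), ha, mul_one]⟩
  let H : Subgroup (GroupCompletion V)ˣ :=
    { carrier := {g | g ∈ P ∧ g⁻¹ ∈ P}
      one_mem' := ⟨P.one_mem, by simp [P.one_mem]⟩
      mul_mem' := fun {a b} ha hb => ⟨P.mul_mem ha.1 hb.1, by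
        rw [mul_inv]; exact P.mul_mem ha.2 hb.2⟩
      inv_mem' := fun {a} ha => ⟨ha.2, by simpa using ha.1⟩ }
  have hC : ∀ g : (GroupCompletion V)ˣ, (g : (GroupCompletion V)ˣ ⧸ H) ∈
      P.map (QuotientGroup.mk' H) ↔ g ∈ P := by
    intro g
    refine ⟨?_, fun hg => ⟨g, hg, rfl⟩⟩
    rintro ⟨h, hh, e⟩
    have : h⁻¹ * g ∈ H := QuotientGroup.eq.1 e
    simpa using P.mul_mem hh this.1
  let C : GroupCone ((GroupCompletion V)ˣ ⧸ H) :=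
    { P.map (QuotientGroup.mk' H) with
      eq_one_of_mem_of_inv_mem' := by
        intro x hx hx'
        obtain ⟨g, rfl⟩ := QuotientGroup.mk_surjective x
        exact (QuotientGroup.eq_one_iff g).2 ⟨(hC g).1 hx, (hC g⁻¹).1 hx'⟩ }
  have : HasMemOrInvMem C := ⟨fun x => by
    obtain ⟨g, rfl⟩ := QuotientGroup.mk_surjective x
    exact (hP g).imp (hC g).2 (hC g⁻¹).2⟩
  let _ : LinearOrder ((GroupCompletion V)ˣ ⧸ H) := LinearOrder.mkOfGroupCone C
  have _ : IsOrderedMonoid ((GroupCompletion V)ˣ ⧸ H) := IsOrderedMonoid.mkOfCone C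
  refine ⟨(GroupCompletion V)ˣ ⧸ H, inferInstance, inferInstance, inferInstance,
    QuotientGroup.mk' H, fun g => Iff.trans ?_ (hC g)⟩
  change (g : (GroupCompletion V)ˣ ⧸ H) / 1 ∈ C ↔ _
  rw [div_one]
  rfl

open HahnSeries in
/-- The valuation ring of Hahn series of non-negative order. -/
def HahnSeries.valuationSubring (Γ k : Type u) [AddCommGroup Γ] [LinearOrder Γ]
    [IsOrderedAddMonoid Γ] [Field k] : ValuationSubring (HahnSeries Γ k) where
  carrier := {x | 0 ≤ addVal Γ k x}
  mul_mem' {x y} hx hy := by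
    change 0 ≤ addVal Γ k (x * y)
    rw [AddValuation.map_mul]
    exact add_nonneg hx hy
  one_mem' := by
    change 0 ≤ addVal Γ k 1
    rw [AddValuation.map_one]
  add_mem' {x y} hx hy := by
    change 0 ≤ addVal Γ k (x + y)
    exact AddValuation.map_le_add _ hx hy
  zero_mem' := by
    change 0 ≤ addVal Γ k 0
    rw [AddValuation.map_zero]
    exact le_top
  neg_mem' {x} hx := by
    change 0 ≤ addVal Γ k (-x)
    rwa [AddValuation.map_neg]
  mem_or_inv_mem' x := by
    change 0 ≤ addVal Γ k x ∨ 0 ≤ addVal Γ k x⁻¹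
    rcases eq_or_ne x 0 with rfl | hx
    · exact Or.inl (by rw [AddValuation.map_zero]; exact le_top)
    · rw [addVal_apply_of_ne hx, addVal_apply_of_ne (inv_ne_zero hx), ← WithTop.coe_zero,
        WithTop.coe_le_coe, WithTop.coe_le_coe]
      have h : x.order + x⁻¹.order = 0 := by
        rw [← order_mul hx (inv_ne_zero hx), mul_inv_cancel₀ hx, order_one]
      by_contra! hlt
      exact (add_neg hlt.1 hlt.2).ne h

theorem HahnSeries.mem_valuationSubring {Γ k : Type u} [AddCommGroup Γ] [LinearOrder Γ]
    [IsOrderedAddMonoid Γ] [Field k] {x : HahnSeries Γ k} :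
    x ∈ valuationSubring Γ k ↔ 0 ≤ addVal Γ k x := Iff.rfl

/-- A valuation monoid `V` can be detected in a valuation ring over any field `k`: there is such a
ring `R`, with field of fractions `F`, and a map `V⁺ → F` under which `V` is the preimage of `R`.
The ring consists of the Hahn series of non-negative order with exponents in the value group of
`V`. The map sends the units of `V` to `1`; it is injective only if `1` is the only unit
of `V`. -/
theorem ValuationMonoid.exists_valuationRing (k : Type u) [Field k] (V : Type u)
    [CommMonoidWithZero V] [ValuationMonoid V] :
    ∃ (R F : Type u) (_ : CommRing R) (_ : IsDomain R) (_ : ValuationRing R) (_ : Field F)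
      (_ : Algebra R F) (_ : IsFractionRing R F) (_ : k →+* R) (θ : GroupCompletion V →*₀ F),
      ∀ g, (∃ r, algebraMap R F r = θ g) ↔ ∃ a, toGroupCompletion V a = g := by
  classical
  obtain ⟨Γ', _, _, _, v, hv⟩ := exists_valueGroup V
  let Γ := Additive Γ'
  let θ : GroupCompletion V →*₀ HahnSeries Γ k :=
    { toFun := fun g =>
        if h : IsUnit g then HahnSeries.single (Additive.ofMul (v h.unit) : Γ) 1 else 0
      map_zero' := dif_neg not_isUnit_zero
      map_one' := by
        rw [dif_pos isUnit_one, IsUnit.unit_one, map_one v]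
        rfl
      map_mul' := fun g h => by
        by_cases hg : IsUnit g
        · by_cases hh : IsUnit h
          · rw [dif_pos hg, dif_pos hh, dif_pos (hg.mul hh), HahnSeries.single_mul_single, one_mul,
              ← ofMul_mul, ← map_mul]
            congr 4
            exact Units.ext rfl
          · rw [dif_neg hh, mul_zero, dif_neg fun h' => hh (isUnit_of_mul_isUnit_right h')]
        · rw [dif_neg hg, zero_mul, dif_neg fun h' => hg (isUnit_of_mul_isUnit_left h')] }
  have hθ : ∀ g (h : IsUnit g), θ g = HahnSeries.single (Additive.ofMul (v h.unit) : Γ) 1 :=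
    fun g h => dif_pos h
  let ρ : k →+* HahnSeries.valuationSubring Γ k :=
    (HahnSeries.C : k →+* HahnSeries Γ k).codRestrict (HahnSeries.valuationSubring Γ k).toSubring
      fun c => by
        rw [ValuationSubring.mem_toSubring, HahnSeries.mem_valuationSubring,
          HahnSeries.addVal_apply]
        exact HahnSeries.orderTop_single_le
  refine ⟨HahnSeries.valuationSubring Γ k, HahnSeries Γ k, inferInstance, inferInstance,
    inferInstance, inferInstance, inferInstance, inferInstance, ρ, θ, fun g => ?_⟩
  have h₁ : (∃ r, algebraMap (HahnSeries.valuationSubring Γ k) (HahnSeries Γ k) r = θ g) ↔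
      0 ≤ HahnSeries.addVal Γ k (θ g) :=
    ⟨fun ⟨r, hr⟩ => hr ▸ HahnSeries.mem_valuationSubring.1 r.2,
      fun h => ⟨⟨θ g, HahnSeries.mem_valuationSubring.2 h⟩, rfl⟩⟩
  rw [h₁]
  by_cases hg : IsUnit g
  · rw [hθ g hg, HahnSeries.addVal_apply, HahnSeries.orderTop_single one_ne_zero,
      ← WithTop.coe_zero, WithTop.coe_le_coe, ← ofMul_one, Additive.ofMul_le, hv, IsUnit.unit_spec]
  · obtain rfl : g = 0 := by_contra fun h => hg (GroupCompletion.isUnit_of_ne_zero h)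
    rw [map_zero, AddValuation.map_zero]
    exact ⟨fun _ => ⟨0, map_zero _⟩, fun _ => le_top⟩

/-- If `V` is the preimage of `R` under `θ : V⁺ → F`, then `θ` restricts to a map `V → R`, which
reflects units. -/
theorem ValuationMonoid.exists_restrict (V : Type u) [CommMonoidWithZero V] [ValuationMonoid V]
    {R F : Type u} [CommRing R] [Field F] [Algebra R F] (hι : Function.Injective (algebraMap R F))
    (θ : GroupCompletion V →*₀ F)
    (hθ : ∀ g, (∃ r, algebraMap R F r = θ g) ↔ ∃ a, toGroupCompletion V a = g) :
    ∃ α : V →*₀ R, θ.comp (toGroupCompletion V) = (algebraMap R F).toMonoidWithZeroHom.comp α ∧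
      ∀ a, IsUnit (α a) → IsUnit a := by
  choose σ hσ using fun a => (hθ (toGroupCompletion V a)).2 ⟨a, rfl⟩
  let α : V →*₀ R :=
    { toFun := σ
      map_zero' := hι (by rw [hσ, map_zero, map_zero, map_zero])
      map_one' := hι (by rw [hσ, map_one, map_one, map_one])
      map_mul' := fun a b => hι (by rw [hσ, map_mul, map_mul, map_mul, hσ, hσ]) }
  refine ⟨α, ?_, fun a ha => ?_⟩
  · ext a
    exact (hσ a).symm
  · obtain ⟨r, hr⟩ := isUnit_iff_exists_inv.1 ha
    have hr' : θ (toGroupCompletion V a) * algebraMap R F r = 1 := by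
      rw [← hσ, ← map_mul]
      exact (congrArg _ hr).trans (map_one _)
    have h0 : toGroupCompletion V a ≠ 0 := fun h => by simp [h] at hr'
    obtain ⟨g, hg⟩ := isUnit_iff_exists_inv.1 (GroupCompletion.isUnit_of_ne_zero h0)
    have hg' : algebraMap R F r = θ g := by
      refine mul_left_cancel₀ (left_ne_zero_of_mul_eq_one hr') (hr'.trans ?_)
      rw [← map_mul, hg, map_one]
    obtain ⟨b, rfl⟩ := (hθ g).1 ⟨r, hg'⟩
    refine isUnit_iff_exists_inv.2 ⟨b, toGroupCompletion_injective V ?_⟩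
    rw [map_mul, hg, map_one]

instance (R : Type u) [CommRing R] [IsDomain R] [ValuationRing R] : ValuationMonoid R where
  mem_or_inv_mem α hα := by
    have key : ∀ r : R, toGroupCompletion R r = algebraMap R (FractionRing R) r := fun r =>
      Localization.mk_one_eq_algebraMap r
    rcases ValuationRing.isInteger_or_isInteger R (α : FractionRing R) with ⟨a, ha⟩ | ⟨a, ha⟩
    · exact Or.inl ⟨a, (key a).trans ha⟩
    · refine Or.inr ⟨a, (congrArg _ ((key a).trans ha)).trans ?_⟩
      exact mul_inv_cancel₀ (G₀ := FractionRing R) hα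

/-- The group completion of the multiplicative monoid of a domain is its field of fractions. -/
theorem exists_groupCompletion_equiv (R K : Type u) [CommRing R] [IsDomain R] [Field K]
    [Algebra R K] [IsFractionRing R K] :
    ∃ (e : GroupCompletion R →*₀ K) (e' : K →*₀ GroupCompletion R),
      e.comp (toGroupCompletion R) = (algebraMap R K).toMonoidWithZeroHom ∧
      e'.comp (algebraMap R K).toMonoidWithZeroHom = toGroupCompletion R ∧
      e.comp e' = MonoidWithZeroHom.id K := by
  let E : FractionRing R ≃ₐ[R] K :=
    IsLocalization.algEquiv (nonZeroDivisors R) (FractionRing R) K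
  refine ⟨(E : FractionRing R →+* K).toMonoidWithZeroHom,
    (E.symm : K →+* FractionRing R).toMonoidWithZeroHom, ?_, ?_, ?_⟩
  · ext a
    exact (congrArg E (Localization.mk_one_eq_algebraMap a)).trans (E.commutes a)
  · ext a
    exact (E.symm.commutes a).trans (Localization.mk_one_eq_algebraMap a).symm
  · ext a
    exact E.apply_symm_apply a

/-! ### Lifting along the spectrum of a valuation monoid -/

namespace MSpec

theorem map_comp_map {A B C : Type u} [CommMonoidWithZero A] [CommMonoidWithZero B]
    [CommMonoidWithZero C] (φ : A →*₀ B) (ψ : B →*₀ C) : map ψ ≫ map φ = map (ψ.comp φ) := by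
  refine MonoidSpace.MSpec_hom_ext (fun _ => rfl) fun U s p hp hp' => ?_
  change p.locMap ψ ((p.comap ψ).locMap φ (s.val ⟨_, hp⟩)) = p.locMap (ψ.comp φ) (s.val ⟨_, hp'⟩)
  have key : ∀ x : Localization ((p.comap ψ).comap φ).compl,
      p.locMap ψ ((p.comap ψ).locMap φ x) = p.locMap (ψ.comp φ) x := by
    intro x
    induction x using Localization.induction_on with | H y => ?_
    rfl
  exact key _

theorem map_id (A : Type u) [CommMonoidWithZero A] :
    map (MonoidWithZeroHom.id A) = 𝟙 (MSpec A) := by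
  refine MonoidSpace.MSpec_hom_ext (fun _ => rfl) fun U s p hp hp' => ?_
  change p.locMap (.id A) (s.val ⟨_, hp⟩) = s.val ⟨_, hp'⟩
  have key : ∀ x : Localization p.compl, p.locMap (.id A) x = x := by
    intro x
    induction x using Localization.induction_on with | H y => ?_
    rfl
  exact key _

end MSpec

namespace MonoidSpace

variable {X Y : MonoidSpace.{u}} {V P R F : Type u} [CommMonoidWithZero V] [CommMonoidWithZero P]
  [CommMonoidWithZero R] [CommMonoidWithZero F]

/-- Let `j : V → P` be injective and let `α : V → R` reflect units. A morphism out of `MSpec V` is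
determined by its restrictions to `MSpec P` and `MSpec R`: the restriction to `MSpec R` determines
the image of the closed point, and the restriction to `MSpec P` the map on sections. -/
theorem eq_of_map_comp_eq [Nontrivial V] [Nontrivial P] [Nontrivial R] [X.IsMonoidScheme]
    (j : V →*₀ P) (hj : Function.Injective j)
    (α : V →*₀ R) (hα : ∀ a, IsUnit (α a) → IsUnit a) {l l' : MSpec V ⟶ X}
    (h : MSpec.map α ≫ l = MSpec.map α ≫ l') (h' : MSpec.map j ≫ l = MSpec.map j ≫ l') :
    l = l' := by
  have e : l.base (MPrime.closedPoint V) = l'.base (MPrime.closedPoint V) := by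
    rw [← MPrime.comap_closedPoint α hα]
    exact congrArg (fun g : MSpec R ⟶ X => g.base (MPrime.closedPoint R)) h
  obtain ⟨W, hxW, hW⟩ := IsMonoidScheme.exists_isAffineOpen (l.base (MPrime.closedPoint V))
  obtain ⟨φ, H⟩ := exists_isChart l hxW
  obtain ⟨φ', H'⟩ := exists_isChart l' (e ▸ hxW)
  have hφ : φ = φ' := by
    have := (H.map_comp j).unique (h' ▸ H'.map_comp j)
    ext a
    exact hj (DFunLike.congr_fun this a)
  subst hφ
  exact IsChart.hom_ext hW H H'

/-- Suppose that `V` is the fibre product of `P` and `R` over `F`, and that all non-zero elements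
of `P` are units. Then compatible morphisms out of `MSpec P` and `MSpec R` come from a
morphism out of `MSpec V`. -/
theorem exists_map_comp_eq [Nontrivial P] [Nontrivial R] [Nontrivial F] [X.IsMonoidScheme]
    (j : V →*₀ P) (hj : Function.Injective j)
    (α : V →*₀ R) (θ : P →*₀ F) (ι : R →*₀ F) (hι : Function.Injective ι)
    (hc : θ.comp j = ι.comp α) (hP : ∀ a : P, a ≠ 0 → IsUnit a)
    (hV : ∀ p r, ι r = θ p → ∃ a, j a = p) (ξ : MSpec P ⟶ X) (l : MSpec R ⟶ X)
    (h : MSpec.map θ ≫ ξ = MSpec.map ι ≫ l) :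
    ∃ m : MSpec V ⟶ X, MSpec.map j ≫ m = ξ ∧ MSpec.map α ≫ m = l := by
  obtain ⟨W, hxW, hW⟩ := IsMonoidScheme.exists_isAffineOpen (l.base (MPrime.closedPoint R))
  obtain ⟨ψ, H⟩ := exists_isChart l hxW
  have hξ : ξ.base (MPrime.closedPoint P) ∈ W := by
    rw [← MPrime.eq_closedPoint_of_forall_isUnit hP (MPrime.comap θ (MPrime.closedPoint F))]
    have e : (MSpec.map θ ≫ ξ).base (MPrime.closedPoint F) =
      (MSpec.map ι ≫ l).base (MPrime.closedPoint F) := by rw [h]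
    exact Set.mem_of_eq_of_mem e (H.mem (MPrime.comap ι (MPrime.closedPoint F)))
  obtain ⟨φ, H'⟩ := exists_isChart ξ hξ
  have hφ : θ.comp φ = ι.comp ψ := (H'.map_comp θ).unique (h ▸ H.map_comp ι)
  -- Over `W`, the sections of `X` map to the fibre product of `P` and `R`, that is, to `V`.
  choose σ hσ using fun a => hV (φ a) (ψ a) (DFunLike.congr_fun hφ a).symm
  let φ₀ : X.presheaf.obj (op W) →*₀ V :=
    { toFun := σ
      map_zero' := hj (by rw [hσ, map_zero, map_zero])
      map_one' := hj (by rw [hσ, map_one, map_one])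
      map_mul' := fun a b => hj (by rw [hσ, map_mul, map_mul, hσ, hσ]) }
  have h₁ : j.comp φ₀ = φ := by
    ext a
    exact hσ a
  have h₂ : α.comp φ₀ = ψ := by
    ext a
    apply hι
    calc ι (α (φ₀ a)) = θ (j (φ₀ a)) := (DFunLike.congr_fun hc _).symm
      _ = ι (ψ a) := (congrArg θ (hσ a)).trans (DFunLike.congr_fun hφ a)
  obtain ⟨m, hm⟩ := hW.exists_hom ⟨_, hxW⟩ φ₀
  exact ⟨m, IsChart.hom_ext hW (h₁ ▸ hm.map_comp j) H', IsChart.hom_ext hW (h₂ ▸ hm.map_comp α) H⟩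

/-- The existence part of the valuative criterion for morphisms of monoid spaces. -/
def ValuativeExistence (f : X ⟶ Y) : Prop :=
  ∀ (V : Type u) [CommMonoidWithZero V] [ValuationMonoid V]
    (i₁ : MSpec (GroupCompletion V) ⟶ X) (i₂ : MSpec V ⟶ Y),
    i₁ ≫ f = MSpec.map (toGroupCompletion V) ≫ i₂ →
    ∃ l : MSpec V ⟶ X, MSpec.map (toGroupCompletion V) ≫ l = i₁ ∧ l ≫ f = i₂

theorem valuativeCriterionProper_iff (f : X ⟶ Y) :
    ValuativeCriterionProper f ↔ ValuativeExistence f ∧ ValuativeCriterionSeparated f := by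
  constructor
  · intro h
    exact ⟨fun V _ _ i₁ i₂ w => (h V i₁ i₂ w).exists,
      fun V _ _ i₁ i₂ w l l' hl hl' => (h V i₁ i₂ w).unique hl hl'⟩
  · rintro ⟨h, h'⟩ V _ _ i₁ i₂ w
    obtain ⟨l, hl⟩ := h V i₁ i₂ w
    exact ⟨l, hl, fun l' hl' => h' V i₁ i₂ w l' l hl' hl⟩

/-! ### Comparison of the two criteria -/

section Comparison

variable [X.IsMonoidScheme] [Y.IsMonoidScheme] {k : Type u} [CommRing k] {f : X ⟶ Y}
  {R K : Type u} [CommRing R] [IsLocalRing R] [Field K] [Algebra R K]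

/-- The lifts in a square over `f_k` correspond to the lifts in the corresponding square over
`f`. -/
theorem isLift_iff_of_realizes {i₁ : Spec (CommRingCat.of K) ⟶ realization k X}
    {i₂ : Spec (CommRingCat.of R) ⟶ realization k Y} {ρ₁ : k →+* K} {ρ₂ : k →+* R}
    {h₁ : MSpec K ⟶ X} {h₂ : MSpec R ⟶ Y} (H₁ : Realizes i₁ ρ₁ h₁) (H₂ : Realizes i₂ ρ₂ h₂)
    (w : i₁ ≫ realizationMap k f = Spec.map (CommRingCat.ofHom (algebraMap R K)) ≫ i₂)
    {s : Spec (CommRingCat.of R) ⟶ realization k X} {ρ : k →+* R} {l : MSpec R ⟶ X}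
    (H : Realizes s ρ l) :
    (Spec.map (CommRingCat.ofHom (algebraMap R K)) ≫ s = i₁ ∧ s ≫ realizationMap k f = i₂) ↔
      ρ = ρ₂ ∧ MSpec.map (algebraMap R K).toMonoidWithZeroHom ≫ l = h₁ ∧ l ≫ f = h₂ := by
  constructor
  · rintro ⟨rfl, rfl⟩
    obtain ⟨rfl, rfl⟩ := (H.comp f).right_unique H₂
    exact ⟨rfl, ((H.map_comp (algebraMap R K)).right_unique H₁).2, rfl⟩
  · rintro ⟨rfl, rfl, rfl⟩
    obtain ⟨rfl, -⟩ := (w ▸ H₁.comp f).right_unique (H₂.map_comp (algebraMap R K))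
    exact ⟨(H.map_comp (algebraMap R K)).left_unique H₁, (H.comp f).left_unique H₂⟩

end Comparison

section

variable [X.IsMonoidScheme] [Y.IsMonoidScheme] {f : X ⟶ Y} (k : Type u) [CommRing k]

theorem ValuativeCriterionSeparated.realizationMap (hf : ValuativeCriterionSeparated f) :
    ValuativeCriterion.Uniqueness (realizationMap k f) := by
  rintro ⟨R, K, i₁, i₂, ⟨w⟩⟩
  refine ⟨fun ⟨s, hs, hs'⟩ ⟨t, ht, ht'⟩ => ?_⟩
  obtain ⟨ρ₁, h₁, H₁⟩ := exists_realizes_left i₁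
  obtain ⟨ρ₂, h₂, H₂⟩ := exists_realizes_left i₂
  obtain ⟨ρ, l, H⟩ := exists_realizes_left s
  obtain ⟨ρ', l', H'⟩ := exists_realizes_left t
  obtain ⟨rfl, hl, hl'⟩ := (isLift_iff_of_realizes H₁ H₂ w H).1 ⟨hs, hs'⟩
  obtain ⟨rfl, hm, hm'⟩ := (isLift_iff_of_realizes H₁ H₂ w H').1 ⟨ht, ht'⟩
  -- The criterion for `f` concerns `R⁺`, which is isomorphic to `K`.
  obtain ⟨e, e', he, he', -⟩ := exists_groupCompletion_equiv R K
  obtain rfl : l = l' := by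
    refine hf R (MSpec.map e' ≫ h₁) h₂ ?_ l l' ⟨?_, hl'⟩ ⟨?_, hm'⟩
    · rw [Category.assoc, ← hl, Category.assoc, hl', ← Category.assoc, MSpec.map_comp_map, he']
    · rw [← hl, ← Category.assoc, MSpec.map_comp_map, he']
    · rw [← hm, ← Category.assoc, MSpec.map_comp_map, he']
  obtain rfl := H.left_unique H'
  rfl

theorem ValuativeExistence.realizationMap (hf : ValuativeExistence f) :
    ValuativeCriterion.Existence (realizationMap k f) := by
  rintro ⟨R, K, i₁, i₂, ⟨w⟩⟩
  obtain ⟨ρ₁, h₁, H₁⟩ := exists_realizes_left i₁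
  obtain ⟨ρ₂, h₂, H₂⟩ := exists_realizes_left i₂
  have hw := ((H₁.comp f).right_unique (w ▸ H₂.map_comp (algebraMap R K))).2
  obtain ⟨e, e', he, he', hee'⟩ := exists_groupCompletion_equiv R K
  obtain ⟨l, hl, hl'⟩ := hf R (MSpec.map e' ≫ h₁) h₂ (by
    rw [Category.assoc, hw, ← Category.assoc, MSpec.map_comp_map, he'])
  obtain ⟨s, H⟩ := exists_realizes_right ρ₂ l
  obtain ⟨hs, hs'⟩ := (isLift_iff_of_realizes H₁ H₂ w H).2 ⟨rfl, by
    rw [← he, ← MSpec.map_comp_map, Category.assoc, hl, ← Category.assoc, MSpec.map_comp_map, hee',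
      MSpec.map_id, Category.id_comp], hl'⟩
  exact ⟨⟨s, hs, hs'⟩⟩

end

section

variable [X.IsMonoidScheme] [Y.IsMonoidScheme] {f : X ⟶ Y} {k : Type u} [Field k]

/-- A square over `f` induces a square over `f_k` along a map `θ : V⁺ → F` restricting to
`α : V → R`. -/
theorem exists_realizes_square {V : Type u} [CommMonoidWithZero V]
    (i₁ : MSpec (GroupCompletion V) ⟶ X) (i₂ : MSpec V ⟶ Y)
    (w : i₁ ≫ f = MSpec.map (toGroupCompletion V) ≫ i₂) {R F : Type u} [CommRing R] [Nontrivial R]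
    [Field F] [Algebra R F] (ρ : k →+* R) (θ : GroupCompletion V →*₀ F) (α : V →*₀ R)
    (hα : θ.comp (toGroupCompletion V) = (algebraMap R F).toMonoidWithZeroHom.comp α) :
    ∃ (s₁ : Spec (CommRingCat.of F) ⟶ realization k X)
      (s₂ : Spec (CommRingCat.of R) ⟶ realization k Y),
      Realizes s₁ ((algebraMap R F).comp ρ) (MSpec.map θ ≫ i₁) ∧
      Realizes s₂ ρ (MSpec.map α ≫ i₂) ∧
      s₁ ≫ realizationMap k f = Spec.map (CommRingCat.ofHom (algebraMap R F)) ≫ s₂ := by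
  obtain ⟨s₁, H₁⟩ := exists_realizes_right ((algebraMap R F).comp ρ) (MSpec.map θ ≫ i₁)
  obtain ⟨s₂, H₂⟩ := exists_realizes_right ρ (MSpec.map α ≫ i₂)
  have w' : (MSpec.map θ ≫ i₁) ≫ f =
      MSpec.map (algebraMap R F).toMonoidWithZeroHom ≫ MSpec.map α ≫ i₂ := by
    rw [Category.assoc, w, ← Category.assoc, ← Category.assoc, MSpec.map_comp_map,
      MSpec.map_comp_map, hα]
  exact ⟨s₁, s₂, H₁, H₂, (H₁.comp f).left_unique (w' ▸ H₂.map_comp (algebraMap R F))⟩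

theorem valuativeCriterionSeparated_of_realizationMap
    (hf : ValuativeCriterion.Uniqueness (realizationMap k f)) : ValuativeCriterionSeparated f := by
  rintro V _ _ i₁ i₂ w l l' ⟨hl, hl'⟩ ⟨hm, hm'⟩
  obtain ⟨R, F, _, _, _, _, _, _, ρ, θ, hθ⟩ := ValuationMonoid.exists_valuationRing k V
  obtain ⟨α, hα, hu⟩ := ValuationMonoid.exists_restrict V (IsFractionRing.injective R F) θ hθ
  obtain ⟨s₁, s₂, H₁, H₂, wk⟩ := exists_realizes_square i₁ i₂ w ρ θ α hα
  obtain ⟨s, H⟩ := exists_realizes_right ρ (MSpec.map α ≫ l)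
  obtain ⟨s', H'⟩ := exists_realizes_right ρ (MSpec.map α ≫ l')
  have hs := (isLift_iff_of_realizes H₁ H₂ wk H).2 ⟨rfl, by
    rw [← Category.assoc, MSpec.map_comp_map, ← hα, ← hl, ← MSpec.map_comp_map, Category.assoc], by
    rw [Category.assoc, hl']⟩
  have hs' := (isLift_iff_of_realizes H₁ H₂ wk H').2 ⟨rfl, by
    rw [← Category.assoc, MSpec.map_comp_map, ← hα, ← hm, ← MSpec.map_comp_map, Category.assoc], by
    rw [Category.assoc, hm']⟩
  have := hf ⟨R, F, s₁, s₂, ⟨wk⟩⟩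
  have e : s = s' := congrArg CommSq.LiftStruct.l
    (Subsingleton.elim (⟨s, hs.1, hs.2⟩ : CommSq.LiftStruct ⟨wk⟩) ⟨s', hs'.1, hs'.2⟩)
  exact eq_of_map_comp_eq (toGroupCompletion V) (toGroupCompletion_injective V) α hu
    (H.right_unique (e ▸ H')).2 (hl.trans hm.symm)

theorem valuativeExistence_of_realizationMap
    (hf : ValuativeCriterion.Existence (realizationMap k f)) : ValuativeExistence f := by
  rintro V _ _ i₁ i₂ w
  obtain ⟨R, F, _, _, _, _, _, _, ρ, θ, hθ⟩ := ValuationMonoid.exists_valuationRing k V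
  obtain ⟨α, hα, hu⟩ := ValuationMonoid.exists_restrict V (IsFractionRing.injective R F) θ hθ
  obtain ⟨s₁, s₂, H₁, H₂, wk⟩ := exists_realizes_square i₁ i₂ w ρ θ α hα
  obtain ⟨s, hs, hs'⟩ := (hf ⟨R, F, s₁, s₂, ⟨wk⟩⟩).exists_lift
  obtain ⟨ρ', l, H⟩ := exists_realizes_left s
  obtain ⟨-, hl, hl'⟩ := (isLift_iff_of_realizes H₁ H₂ wk H).1 ⟨hs, hs'⟩
  obtain ⟨m, hm, hm'⟩ := exists_map_comp_eq (toGroupCompletion V) (toGroupCompletion_injective V) α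
    θ (algebraMap R F).toMonoidWithZeroHom (IsFractionRing.injective R F) hα
    (fun _ => GroupCompletion.isUnit_of_ne_zero) (fun p r h => (hθ p).1 ⟨r, h⟩) i₁ l hl.symm
  refine ⟨m, hm, eq_of_map_comp_eq (toGroupCompletion V) (toGroupCompletion_injective V) α hu ?_ ?_⟩
  -- The lift `m` of `i₁` is also a lift of `i₂`, since both restrict to the same morphisms on
  -- `MSpec V⁺` and on `MSpec R`.
  · rw [← Category.assoc, hm', hl']
  · rw [← Category.assoc, hm, w]

end

end MonoidSpace

theorem mainTheorem7 {X Y : MonoidSpace.{u}} [X.IsMonoidScheme] [Y.IsMonoidScheme] (f : X ⟶ Y)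
    (k : Type u) [Field k] :
    (AlgebraicGeometry.ValuativeCriterion (MonoidSpace.realizationMap k f) ↔
      MonoidSpace.ValuativeCriterionProper f) ∧
    (AlgebraicGeometry.ValuativeCriterion.Uniqueness (MonoidSpace.realizationMap k f) ↔
      MonoidSpace.ValuativeCriterionSeparated f) := by
  have h : AlgebraicGeometry.ValuativeCriterion.Uniqueness (MonoidSpace.realizationMap k f) ↔
      MonoidSpace.ValuativeCriterionSeparated f :=
    ⟨MonoidSpace.valuativeCriterionSeparated_of_realizationMap, fun hf => hf.realizationMap k⟩
  refine ⟨?_, h⟩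
  rw [ValuativeCriterion.iff, MonoidSpace.valuativeCriterionProper_iff, h]
  exact and_congr_left' ⟨MonoidSpace.valuativeExistence_of_realizationMap,
    fun hf => hf.realizationMap k⟩
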